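/- \textbf{Theorem (Most-discerning implementation with nonbinary tests).} Let $\Theta$ (types), $T$ (tests) and $X$ (decisions) be Polish spaces with their Borel $\sigma$-algebras, let $S\subset\mathbf{R}$ be finite, let $\pi\colon T\times\Theta\to\Delta(S)$, $(\tau,\theta)\mapsto\pi_{\tau|\theta}$, be a Borel Markov kernel, and let the agent's utility $u\colon X\times\Theta\to\mathbf{R}$ be Borel measurable. Below, a \emph{transition} $k\colon Y\to\Delta(Z)$ between Polish spaces is a map $y\mapsto k_y$ into Borel probability measures such that $y\mapsto k_y(B)$ is universally measurable for every Borel set $B\subset Z$. A social choice function is a transition $f\colon\Theta\to\Delta(X)$. Write $\mu\le_{\mathrm{SD}}\nu$ if $\nu((-\infty,x])\le\mu((-\infty,x])$ for all $x\in\mathbf{R}$ (first-order stochastic dominance). \emph{Implementation.} A mechanism $(M,t,g)$ consists of a Polish message space $M$, a testing rule $t\colon M\to\Delta(T)$ and a decision rule $g\colon M\times T\times S\to\Delta(X)$; a strategy $(r,p)$ consists of a reporting strategy $r\colon\Theta\to\Delta(M)$ and a performance strategy $p\colon\Theta\times M\times T\to\Delta(S)$ with $p_{\theta,m,\tau}\le_{\mathrm{SD}}\pi_{\tau|\theta}$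 for all $(\theta,m,\tau)$; all of $t,g,r,p$ are transitions. The profile $(M,t,g;r,p)$ induces the social choice function \[ B\mapsto\int_M r_\theta(dm)\int_T t_m(d\tau)\sum_{s\in S}p_{\theta,m,\tau}(\{s\})\,g_{m,\tau,s}(B),\qquad \theta\in\Theta . \] The profile is \emph{incentive compatible} if for every type $\theta$ the expected utility $\int_X u(x,\theta)\,\tilde f_\theta(dx)\in[-\infty,\infty]$ is well defined for the social choice function $\tilde f$ induced by each strategy in the mechanism, and is maximized over all strategies by $(r,p)$. It \emph{implements} $f$ if it is incentive compatible and induces $f$; $f$ is \emph{implementable} if some profile implements it. For a testing rule $\hat t\colon\Theta\to\Delta(T)$, $f$ is \emph{canonically implementable with $\hat t$} if, for some decision rule $g$, $f$ is implemented by a profile $(\Theta,\hat t,g;r,p)$ with $r_\theta=\delta_\theta$ and $p_{\theta,\theta,\tau}=\pi_{\tau|\theta}$ for all $\theta\in\Theta$, $\tau\in T$. \emph{Discernment.} A Markov transition $k$ on $S$ is \emph{monotone} if $k_r\ge_{\mathrm{SD}}k_s$ whenever $r>s$. A test $\tau$ is \emph{more $\theta$-discerning} than a test $\psi$ if there is a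 monotone Markov transition $k$ on $S$ with $\pi_{\tau|\theta}k=\pi_{\psi|\theta}$ and $\pi_{\tau|\theta'}k\le_{\mathrm{SD}}\pi_{\psi|\theta'}$ for all $\theta'\ne\theta$, where $(\mu k)(\{s'\})=\sum_{s}\mu(\{s\})k_s(\{s'\})$. A testing function $\hat t\colon\Theta\to T$ is \emph{most discerning} if, for every type $\theta$, $\hat t(\theta)$ is more $\theta$-discerning than every test $\psi\in T$. \emph{Claim.} If a universally measurable testing function $\hat t\colon\Theta\to T$ is most discerning, then every implementable social choice function is canonically implementable with $\hat t$ (identified with the testing rule $\theta\mapsto\delta_{\hat t(\theta)}$). -/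

import Mathlib

open MeasureTheory ProbabilityTheory
open scoped ENNReal

universe w

/-! ### Universal completion and Markov transitions -/

/-- The universal completion of the ambient σ-algebra on `X`: the intersection, over all
probability measures `μ`, of the `μ`-completions of that σ-algebra. -/
@[reducible] def universalCompletion (X : Type*) [MeasurableSpace X] : MeasurableSpace X where
  MeasurableSet' s := ∀ μ : Measure X, IsProbabilityMeasure μ → NullMeasurableSet s μ
  measurableSet_empty _ _ := MeasurableSet.empty.nullMeasurableSet
  measurableSet_compl _ hs μ hμ := (hs μ hμ).compl
  measurableSet_iUnion _ hs μ hμ := NullMeasurableSet.iUnion fun i => hs i μ hμ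

/-- A Markov transition `X → Δ(Y)` that is universally measurable. Since a probability measure on
`Y` extends uniquely to the universal completion of the σ-algebra of `Y`, these are the Markov
transitions between the universal completions of `X` and `Y`. -/
structure MarkovTransition (X Y : Type*) [MeasurableSpace X] [MeasurableSpace Y] where
  toFun : X → Measure Y
  isProbabilityMeasure : ∀ x, IsProbabilityMeasure (toFun x)
  measurable_apply : ∀ B : Set Y, MeasurableSet B →
    Measurable[universalCompletion X] fun x => toFun x B

section Aux

variable {X Y Z : Type*} [MeasurableSpace X] [MeasurableSpace Y] [MeasurableSpace Z]

theorem le_universalCompletion : ‹MeasurableSpace X› ≤ universalCompletion X :=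
  fun _ hs _ _ => hs.nullMeasurableSet

theorem measurable_universalCompletion {f : X → Y} (hf : Measurable f) :
    Measurable[universalCompletion X, universalCompletion Y] f := by
  intro s hs μ hμ
  have : IsProbabilityMeasure (μ.map f) := Measure.isProbabilityMeasure_map hf.aemeasurable
  exact (hs (μ.map f) this).preimage ⟨hf, Measure.AbsolutelyContinuous.rfl⟩

theorem aemeasurable_of_universal {h : X → ℝ≥0∞} (hh : Measurable[universalCompletion X] h)
    (μ : Measure X) [hμ : IsProbabilityMeasure μ] : AEMeasurable h μ := by
  apply NullMeasurable.aemeasurable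
  intro s hs
  exact hh hs μ hμ

theorem measurable_of_forall_aemeasurable {h : X → ℝ≥0∞}
    (hh : ∀ μ : Measure X, IsProbabilityMeasure μ → AEMeasurable h μ) :
    Measurable[universalCompletion X] h :=
  fun _ hs μ hμ => (hh μ hμ).nullMeasurable hs

end Aux

namespace MarkovTransition

section Operations

variable {X Y Z : Type*} [MeasurableSpace X] [MeasurableSpace Y] [MeasurableSpace Z]

instance : CoeFun (MarkovTransition X Y) (fun _ => X → Measure Y) := ⟨toFun⟩

instance (k : MarkovTransition X Y) (x : X) : IsProbabilityMeasure (k x) :=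
  k.isProbabilityMeasure x

/-- The transition as a Mathlib kernel out of the universal completion. -/
def toKernel (k : MarkovTransition X Y) : Kernel[universalCompletion X] X Y :=
  @Kernel.mk X Y (universalCompletion X) _ k
    (@Measure.measurable_of_measurable_coe Y X _ (universalCompletion X) k k.measurable_apply)

instance (k : MarkovTransition X Y) : IsMarkovKernel k.toKernel :=
  @IsMarkovKernel.mk X Y (universalCompletion X) _ _ k.isProbabilityMeasure

/-- The Markov transition given by a (Borel) Markov kernel. -/
def ofKernel (κ : Kernel X Y) [IsMarkovKernel κ] : MarkovTransition X Y where
  toFun := κ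
  isProbabilityMeasure _ := inferInstance
  measurable_apply _ hB := (κ.measurable_coe hB).mono le_universalCompletion le_rfl

/-- A universally measurable function `f`, identified with the transition `x ↦ δ_{f x}`. -/
noncomputable def deterministic (f : X → Y) (hf : Measurable[universalCompletion X] f) :
    MarkovTransition X Y where
  toFun x := Measure.dirac (f x)
  isProbabilityMeasure _ := inferInstance
  measurable_apply B hB :=
    (@Measure.measurable_coe Y _ B hB).comp (Measure.measurable_dirac.comp hf)

/-- The identity transition `x ↦ δ_x`. -/
noncomputable def id (X : Type*) [MeasurableSpace X] : MarkovTransition X X :=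
  deterministic (fun x => x) le_universalCompletion

/-- The transition `x ↦ k (f x)`, for a measurable `f`. -/
def comap (k : MarkovTransition Y Z) (f : X → Y) (hf : Measurable f) : MarkovTransition X Z where
  toFun x := k (f x)
  isProbabilityMeasure _ := inferInstance
  measurable_apply B hB := (k.measurable_apply B hB).comp (measurable_universalCompletion hf)

/-- The transition `x ↦ δ_x ⊗ k_x`, which carries `X` along. -/
noncomputable def carry (k : MarkovTransition X Y) : MarkovTransition X (X × Y) where
  toFun x := (k x).map (Prod.mk x)
  isProbabilityMeasure x :=
    Measure.isProbabilityMeasure_map measurable_prodMk_left.aemeasurable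
  measurable_apply E hE := by
    simp_rw [Measure.map_apply measurable_prodMk_left hE]
    have hE' : @MeasurableSet (X × Y) (@Prod.instMeasurableSpace X Y (universalCompletion X) _) E :=
      (sup_le_sup (MeasurableSpace.comap_mono le_universalCompletion) le_rfl) E hE
    exact @Kernel.measurable_kernel_prodMk_left X Y (universalCompletion X) _ k.toKernel _ E hE'

/-- The measure `μ k`, given by `(μ k)(B) = ∫ k(x, B) μ(dx)`. -/
noncomputable def act (k : MarkovTransition X Y) (μ : Measure X) [IsProbabilityMeasure μ] :
    Measure Y :=
  Measure.ofMeasurable (fun B _ => ∫⁻ x, k x B ∂μ) (by simp) (by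
    intro B hB hd
    simp_rw [measure_iUnion hd hB]
    exact lintegral_tsum fun i => aemeasurable_of_universal (k.measurable_apply _ (hB i)) μ)

theorem act_apply (k : MarkovTransition X Y) (μ : Measure X) [IsProbabilityMeasure μ]
    {B : Set Y} (hB : MeasurableSet B) : k.act μ B = ∫⁻ x, k x B ∂μ :=
  Measure.ofMeasurable_apply B hB

instance (k : MarkovTransition X Y) (μ : Measure X) [IsProbabilityMeasure μ] :
    IsProbabilityMeasure (k.act μ) :=
  ⟨by simp [act_apply]⟩

theorem measurable_lintegral (k : MarkovTransition X Y) {h : X × Y → ℝ≥0∞}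
    (hh : Measurable[universalCompletion (X × Y)] h) :
    Measurable[universalCompletion X] fun x => ∫⁻ y, h (x, y) ∂(k x) := by
  refine measurable_of_forall_aemeasurable fun μ hμ => ?_
  obtain ⟨h', hm, hae⟩ := aemeasurable_of_universal hh (k.carry.act μ)
  have key : ∀ᵐ x ∂μ, ∀ᵐ y ∂(k x), h (x, y) = h' (x, y) := by
    obtain ⟨N, hsub, hN, hN0⟩ := exists_measurable_superset_of_null (ae_iff.1 hae)
    rw [act_apply _ _ hN, lintegral_eq_zero_iff'
      (aemeasurable_of_universal (k.carry.measurable_apply N hN) μ)] at hN0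
    filter_upwards [hN0] with x hx
    have hx' : k x (Prod.mk x ⁻¹' N) = 0 := by
      rw [← Measure.map_apply measurable_prodMk_left hN]; exact hx
    exact measure_mono_null (fun y hy => hsub hy) hx'
  have hm' : @Measurable (X × Y) ℝ≥0∞
      (@Prod.instMeasurableSpace X Y (universalCompletion X) _) _ h' :=
    hm.mono (sup_le_sup (MeasurableSpace.comap_mono le_universalCompletion) le_rfl) le_rfl
  have h1 : Measurable[universalCompletion X] fun x => ∫⁻ y, h' (x, y) ∂(k x) :=
    @Measurable.lintegral_kernel_prod_right' X Y (universalCompletion X) _ k.toKernel _ h' hm'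
  exact (aemeasurable_of_universal h1 μ).congr
    (key.mono fun x hx => (lintegral_congr_ae hx).symm)

/-- Composition: `(k ℓ)(x, C) = ∫ k(x, dy) ℓ(y, C)`. -/
noncomputable def comp (k : MarkovTransition X Y) (l : MarkovTransition Y Z) :
    MarkovTransition X Z where
  toFun x := l.act (k x)
  isProbabilityMeasure _ := inferInstance
  measurable_apply C hC := by
    simp_rw [act_apply _ _ hC]
    exact k.measurable_lintegral
      ((l.measurable_apply C hC).comp (measurable_universalCompletion measurable_snd))

theorem comp_apply (k : MarkovTransition X Y) (l : MarkovTransition Y Z) (x : X)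
    {C : Set Z} (hC : MeasurableSet C) : k.comp l x C = ∫⁻ y, l y C ∂(k x) :=
  act_apply l (k x) hC

/-- Product of `k : X → Δ(Y)` and `m : X × Y → Δ(Z)`: the transition `X → Δ(Y × Z)` with
`(k × m)(x, B × C) = ∫_B k(x, dy) m((x, y), C)`. -/
noncomputable def prod (k : MarkovTransition X Y) (m : MarkovTransition (X × Y) Z) :
    MarkovTransition X (Y × Z) where
  toFun x := (m.comap (Prod.mk x) measurable_prodMk_left).carry.act (k x)
  isProbabilityMeasure _ := inferInstance
  measurable_apply E hE := by
    simp_rw [act_apply _ _ hE]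
    have hE' : MeasurableSet ((fun q : (X × Y) × Z => (q.1.2, q.2)) ⁻¹' E) :=
      (by fun_prop : Measurable fun q : (X × Y) × Z => (q.1.2, q.2)) hE
    have h2 := m.carry.measurable_apply _ hE'
    have h3 : ∀ x y, (m.comap (Prod.mk x) measurable_prodMk_left).carry y E
        = m.carry (x, y) ((fun q : (X × Y) × Z => (q.1.2, q.2)) ⁻¹' E) := by
      intro x y
      change (m (x, y)).map (Prod.mk y) E = (m (x, y)).map (Prod.mk (x, y)) _
      rw [Measure.map_apply measurable_prodMk_left hE,
        Measure.map_apply measurable_prodMk_left hE']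
      rfl
    simp_rw [h3]
    exact k.measurable_lintegral h2

theorem prod_apply_prod (k : MarkovTransition X Y) (m : MarkovTransition (X × Y) Z) (x : X)
    {B : Set Y} {C : Set Z} (hB : MeasurableSet B) (hC : MeasurableSet C) :
    k.prod m x (B ×ˢ C) = ∫⁻ y in B, m (x, y) C ∂(k x) := by
  change (m.comap (Prod.mk x) measurable_prodMk_left).carry.act (k x) (B ×ˢ C) = _
  rw [act_apply _ _ (hB.prod hC), ← lintegral_indicator hB]
  refine lintegral_congr fun y => ?_
  change (m (x, y)).map (Prod.mk y) (B ×ˢ C) = _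
  rw [Measure.map_apply measurable_prodMk_left (hB.prod hC)]
  by_cases hy : y ∈ B <;> simp [hy]

end Operations

end MarkovTransition

/-! ### Stochastic dominance and the discernment orders -/

/-- `SDLE μ ν`: the distribution `ν` on `S ⊂ ℝ` first-order stochastically dominates `μ`, that is
`F_ν(x) ≤ F_μ(x)` for all real `x`. -/
def SDLE {S : Finset ℝ} (μ ν : Measure S) : Prop :=
  ∀ x : ℝ, ν {s : S | (s : ℝ) ≤ x} ≤ μ {s : S | (s : ℝ) ≤ x}

/-- A Markov transition on `S` is monotone if `k_r` dominates `k_s` whenever `r > s`. -/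
def IsMonotoneTransition {S : Finset ℝ} (k : Kernel S S) : Prop :=
  ∀ r s : S, s < r → SDLE (k s) (k r)

section Model

variable {Θ T X M : Type*} [MeasurableSpace Θ] [MeasurableSpace T] [MeasurableSpace X]
  [MeasurableSpace M] {S : Finset ℝ}

/-- The test `τ` is more `θ`-discerning than the test `ψ`. -/
def MoreDiscerning (π : Kernel (T × Θ) S) (θ : Θ) (τ ψ : T) : Prop :=
  ∃ k : Kernel S S, IsMarkovKernel k ∧ IsMonotoneTransition k ∧
    (π (τ, θ)).bind k = π (ψ, θ) ∧
    ∀ θ' : Θ, θ' ≠ θ → SDLE ((π (τ, θ')).bind k) (π (ψ, θ'))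

/-- For each type `θ`, the test `t θ` is most `θ`-discerning. -/
def IsMostDiscerning (π : Kernel (T × Θ) S) (t : Θ → T) : Prop :=
  ∀ (θ : Θ) (ψ : T), MoreDiscerning π θ (t θ) ψ

/-! ### Mechanisms, strategies and implementation -/

/-- A mechanism with message space `M`: a testing rule and a decision rule. -/
structure Mechanism (M T X : Type*) [MeasurableSpace M] [MeasurableSpace T] [MeasurableSpace X]
    (S : Finset ℝ) where
  testing : MarkovTransition M T
  decision : MarkovTransition ((M × T) × S) X

/-- A strategy: a reporting strategy and a performance strategy, whose score distributions are
stochastically dominated by those in `π`. -/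
structure Strategy (π : Kernel (T × Θ) S) (M : Type*) [MeasurableSpace M] where
  report : MarkovTransition Θ M
  perform : MarkovTransition (Θ × M × T) S
  feasible : ∀ (θ : Θ) (m : M) (τ : T), SDLE (perform (θ, m, τ)) (π (τ, θ))

/-- The social choice function `(r × t × p) g` induced by a mechanism and a strategy. -/
noncomputable def inducedSCF {π : Kernel (T × Θ) S} (mech : Mechanism M T X S)
    (σ : Strategy π M) : MarkovTransition Θ X :=
  ((σ.report.prod (mech.testing.comap Prod.snd measurable_snd)).prod σ.perform).comp mech.decision

/-- The positive part `∫ h⁺ dμ` of the expectation of `h`. -/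
noncomputable def posExp (μ : Measure X) (h : X → ℝ) : ℝ≥0∞ := ∫⁻ x, ENNReal.ofReal (h x) ∂μ

/-- The negative part `∫ h⁻ dμ` of the expectation of `h`. -/
noncomputable def negExp (μ : Measure X) (h : X → ℝ) : ℝ≥0∞ := ∫⁻ x, ENNReal.ofReal (-h x) ∂μ

/-- The expectation of `h` under `μ` is well defined (possibly `±∞`). -/
def HasExpectation (μ : Measure X) (h : X → ℝ) : Prop := posExp μ h ≠ ∞ ∨ negExp μ h ≠ ∞

/-- The extended-real expectation of `h` under `μ`, meaningful if `HasExpectation μ h`. -/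
noncomputable def expectation (μ : Measure X) (h : X → ℝ) : EReal :=
  (posExp μ h : EReal) - (negExp μ h : EReal)

/-- The profile is incentive compatible: every type's expected utility is well defined for all
strategies in the mechanism and is maximized by `σ`. -/
def IncentiveCompatible {π : Kernel (T × Θ) S} (u : X × Θ → ℝ) (mech : Mechanism M T X S)
    (σ : Strategy π M) : Prop :=
  ∀ (σ' : Strategy π M) (θ : Θ),
    HasExpectation (inducedSCF mech σ' θ) (fun x => u (x, θ)) ∧
    expectation (inducedSCF mech σ' θ) (fun x => u (x, θ)) ≤
      expectation (inducedSCF mech σ θ) (fun x => u (x, θ))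

/-- The profile implements `f`: it is incentive compatible and induces `f`. -/
def Implements {π : Kernel (T × Θ) S} (u : X × Θ → ℝ) (mech : Mechanism M T X S)
    (σ : Strategy π M) (f : MarkovTransition Θ X) : Prop :=
  IncentiveCompatible u mech σ ∧ f = inducedSCF mech σ

/-- The social choice function `f` is implementable: some profile, with a Polish message space,
implements it. -/
def Implementable (π : Kernel (T × Θ) S) (u : X × Θ → ℝ) (f : MarkovTransition Θ X) : Prop :=
  ∃ (M : Type w) (_ : TopologicalSpace M) (_ : PolishSpace M) (_ : MeasurableSpace M)
    (_ : BorelSpace M) (mech : Mechanism M T X S) (σ : Strategy π M), Implements u mech σ f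

/-- A strategy in a direct mechanism is canonical: the agent reports truthfully and, after a
truthful report, performs to the full on every test. -/
def IsCanonical {π : Kernel (T × Θ) S} (σ : Strategy π Θ) : Prop :=
  σ.report = MarkovTransition.id Θ ∧ ∀ (θ : Θ) (τ : T), σ.perform (θ, θ, τ) = π (τ, θ)

/-- For some decision rule `g`, a canonical profile with the direct mechanism `(t, g)`
implements `f`. -/
def CanonicallyImplementableWith (π : Kernel (T × Θ) S) (u : X × Θ → ℝ)
    (t : MarkovTransition Θ T) (f : MarkovTransition Θ X) : Prop :=
  ∃ (g : MarkovTransition ((Θ × T) × S) X) (σ : Strategy π Θ),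
    IsCanonical σ ∧ Implements u ⟨t, g⟩ σ f

end Model

/-! The original mechanism is simulated inside a direct one. After a report `θ`, the simulator draws
a message `m` from `r_θ` and a test `ψ` from `t_m`, but conducts the test `t θ` instead. It converts
the score on `t θ` into a simulated score on `ψ` and then applies the original decision rule.

The conversion `L` is a composite `K` then `H`. The monotone transition `K` witnesses that `t θ` is
more `θ`-discerning than `ψ`: it carries `π_{tθ|θ}` to `π_{ψ|θ}`. The downward transition `H` lowers
`π_{ψ|θ}` to the performance `p_{θ,m,ψ}` of the original profile. Hence honest full performance
reproduces the original outcome exactly. Conversely, if a type `θ'` produces any feasible score law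
on `t θ`, monotonicity of `K` and the discernment inequalities make the converted law feasible for
`θ'` on `ψ`, and `H` only lowers it further (`IsMostDiscerning.exists_score_conversion`). So every
deviation in the direct mechanism is replicated by a strategy in the original one, and incentive
compatibility is inherited. In the replication, the simulated score depends on a report that the
original performance strategy cannot observe; it is averaged out using the conditional law of the
report given the message (`exists_disintegration`).

The technical burden is measurability. `H` has explicit weights, from the monotone (quantile)
coupling. `K` must be selected: the admissible matrices at `(θ, ψ)` form a nonempty compact convex
set, whose point of least norm is a measurable choice (`exists_measurable_selection`). Admissibility
quantifies over all types, so checking it projects a Borel set; the projection is analytic, hence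
universally measurable. -/

/-! ### Universal measurability of analytic sets. -/

open Filter Topology Set in
/-- Analytic sets are inner regular with respect to compact sets. -/
theorem MeasureTheory.AnalyticSet.exists_isCompact_measure_le {α : Type*} [TopologicalSpace α]
    [MeasurableSpace α] [OpensMeasurableSpace α] (μ : Measure α) [IsFiniteMeasure μ]
    [μ.OuterRegular] {s : Set α} (hs : AnalyticSet s) {ε : ℝ≥0∞} (hε : ε ≠ 0) :
    ∃ K ⊆ s, IsCompact K ∧ μ s ≤ μ K + ε := by
  rw [AnalyticSet] at hs
  rcases hs with rfl | ⟨f, hf, rfl⟩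
  · exact ⟨∅, subset_rfl, isCompact_empty, by simp⟩
  -- Bounding one coordinate costs arbitrarily little mass: continuity from below along increasing
  -- unions holds for outer measure, so the images need not be measurable.
  have step : ∀ (D : Set (ℕ → ℕ)) (i : ℕ) (δ : ℝ≥0∞), δ ≠ 0 →
      ∃ n : ℕ, μ (f '' D) ≤ μ (f '' (D ∩ {x | x i ≤ n})) + δ := by
    intro D i δ hδ
    have hU : f '' D = ⋃ n : ℕ, f '' (D ∩ {x | x i ≤ n}) := by
      rw [← image_iUnion, ← inter_iUnion]
      congr 1
      refine (inter_eq_left.2 fun x _ => mem_iUnion.2 ⟨x i, le_refl (x i)⟩).symm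
    have hmono : Monotone fun n : ℕ => f '' (D ∩ {x | x i ≤ n}) := fun a b hab =>
      image_mono (inter_subset_inter_right _ fun x (hx : x i ≤ a) => hx.trans hab)
    by_cases h0 : μ (f '' D) = 0
    · exact ⟨0, by simp [h0]⟩
    have hlt : μ (f '' D) - δ < μ (f '' D) := ENNReal.sub_lt_self (measure_ne_top _ _) h0 hδ
    conv_rhs at hlt => rw [hU, hmono.measure_iUnion]
    obtain ⟨n, hn⟩ := lt_iSup_iff.1 hlt
    exact ⟨n, tsub_le_iff_right.1 hn.le⟩
  obtain ⟨δ, hδ0, hδ⟩ := ENNReal.exists_pos_sum_of_countable' (ENNReal.half_pos hε).ne' ℕ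
  choose N hN using fun (D : Set (ℕ → ℕ)) (i : ℕ) => step D i (δ i) (hδ0 i).ne'
  let D : ℕ → Set (ℕ → ℕ) := fun k => Nat.rec univ (fun i E => E ∩ {x | x i ≤ N E i}) k
  let n : ℕ → ℕ := fun i => N (D i) i
  have hDs : ∀ k, D (k + 1) = D k ∩ {x | x k ≤ n k} := fun k => rfl
  have hDmem : ∀ k x, x ∈ D k → ∀ i < k, x i ≤ n i := by
    intro k
    induction k with
    | zero => intro x _ i hi; omega
    | succ k ih =>
      intro x hx i hi
      rw [hDs] at hx
      rcases Nat.lt_succ_iff_lt_or_eq.1 hi with h | rfl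
      · exact ih x hx.1 i h
      · exact hx.2
  have hDle : ∀ k, μ (range f) ≤ μ (f '' D k) + ∑ i ∈ Finset.range k, δ i := by
    intro k
    induction k with
    | zero => simp [D]
    | succ k ih =>
      rw [Finset.sum_range_succ, add_comm (Finset.sum _ _), ← add_assoc]
      exact ih.trans (add_le_add_left (hN (D k) k) _)
  let K₀ : Set (ℕ → ℕ) := Set.pi univ fun i => Iic (n i)
  have hK₀ : IsCompact K₀ := isCompact_univ_pi fun i => (finite_Iic (n i)).isCompact
  refine ⟨f '' K₀, image_subset_range _ _, hK₀.image hf, ?_⟩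
  obtain ⟨U, hKU, hU, hμU⟩ := (f '' K₀).exists_isOpen_lt_add (μ := μ) (measure_ne_top _ _)
    (ENNReal.half_pos hε).ne'
  -- The sets `D k` are not compact, but points of `D k` outside `f ⁻¹' U` can be truncated into
  -- `K₀`. Each coordinate is eventually unaffected by truncation, so a subsequence of the points
  -- themselves converges to a point of `K₀`, against openness of `f ⁻¹' U`.
  have hk : ∃ k, D k ⊆ f ⁻¹' U := by
    by_contra hcon
    rw [not_exists] at hcon
    choose x hxD hxU using fun k => not_subset.1 (hcon k)
    obtain ⟨y, hy, φ, hφ, hlim⟩ := hK₀.tendsto_subseq (x := fun k i => min (x k i) (n i))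
      fun k i _ => mem_Iic.2 (min_le_right (x k i) (n i))
    have hlim' : Tendsto (x ∘ φ) atTop (𝓝 y) := by
      rw [tendsto_pi_nhds] at hlim ⊢
      intro i
      refine (hlim i).congr' ?_
      filter_upwards [hφ.tendsto_atTop.eventually (eventually_gt_atTop i)] with k hk
      exact min_eq_left (hDmem _ _ (hxD _) i hk)
    have hc : IsClosed (f ⁻¹' U)ᶜ := (hU.preimage hf).isClosed_compl
    exact hc.mem_of_tendsto hlim' (Eventually.of_forall fun k => hxU _)
      (image_subset_iff.1 hKU hy)
  obtain ⟨k, hk⟩ := hk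
  calc μ (range f) ≤ μ (f '' D k) + ∑ i ∈ Finset.range k, δ i := hDle k
    _ ≤ μ U + ε / 2 := by
        gcongr
        · exact image_subset_iff.2 hk
        · exact (ENNReal.sum_le_tsum _).trans hδ.le
    _ ≤ (μ (f '' K₀) + ε / 2) + ε / 2 := by gcongr
    _ = μ (f '' K₀) + ε := by rw [add_assoc, ENNReal.add_halves]

/-- A countable union of compact subsets exhausts the measure, so the set differs from a Borel set
by a null set. -/
theorem MeasureTheory.AnalyticSet.nullMeasurableSet {α : Type*} [TopologicalSpace α] [T2Space α]
    [MeasurableSpace α] [OpensMeasurableSpace α] (μ : Measure α) [IsFiniteMeasure μ]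
    [μ.OuterRegular] {s : Set α} (hs : AnalyticSet s) : NullMeasurableSet s μ := by
  choose K hKs hK hle using fun n : ℕ =>
    hs.exists_isCompact_measure_le μ (ε := (n + 1 : ℝ≥0∞)⁻¹) (by simp)
  have hB : MeasurableSet (⋃ n, K n) := .iUnion fun n => (hK n).measurableSet
  refine hB.nullMeasurableSet.congr
    (ae_eq_of_subset_of_measure_ge (Set.iUnion_subset hKs) ?_ hB.nullMeasurableSet
      (measure_ne_top _ _))
  have hlim : Filter.Tendsto (fun n : ℕ => μ (⋃ n, K n) + (n + 1 : ℝ≥0∞)⁻¹) Filter.atTop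
      (nhds (μ (⋃ n, K n) + 0)) := by
    refine tendsto_const_nhds.add ?_
    have := (Filter.tendsto_add_atTop_iff_nat 1).2 ENNReal.tendsto_inv_nat_nhds_zero
    simpa using this
  rw [add_zero] at hlim
  refine ge_of_tendsto' hlim fun n => (hle n).trans ?_
  gcongr
  exact Set.subset_iUnion K n

/-- The projection of a Borel set along a Polish space is universally measurable. -/
theorem measurableSet_universalCompletion_setOf_exists {Y Z : Type*}
    [TopologicalSpace Y] [PolishSpace Y] [MeasurableSpace Y] [BorelSpace Y]
    [TopologicalSpace Z] [PolishSpace Z] [MeasurableSpace Z] [BorelSpace Z]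
    {p : Y → Z → Prop} (hp : MeasurableSet {q : Y × Z | p q.1 q.2}) :
    MeasurableSet[universalCompletion Y] {y | ∃ z, p y z} := by
  have h : {y | ∃ z, p y z} = Prod.fst '' {q : Y × Z | p q.1 q.2} := by
    ext y; simp
  rw [h]
  intro μ hμ
  let _ := TopologicalSpace.upgradeIsCompletelyMetrizable Y
  exact (hp.analyticSet.image_of_continuous continuous_fst).nullMeasurableSet μ

/-- Universally measurable maps into standard Borel spaces are measurable for the universal
completions. -/
theorem measurable_universalCompletion_of_measurable {X Y : Type*} [MeasurableSpace X]
    [MeasurableSpace Y] [StandardBorelSpace Y] {f : X → Y}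
    (hf : Measurable[universalCompletion X] f) :
    Measurable[universalCompletion X, universalCompletion Y] f := by
  intro s hs μ hμ
  rcases isEmpty_or_nonempty Y with hY | hY
  · have : IsEmpty X := ⟨fun x => hY.false (f x)⟩
    rw [Set.eq_empty_of_isEmpty (f ⁻¹' s)]
    exact MeasurableSet.empty.nullMeasurableSet
  have hfm : AEMeasurable f μ := by
    apply NullMeasurable.aemeasurable
    intro s hs
    exact hf hs μ hμ
  have : IsProbabilityMeasure (μ.map f) := Measure.isProbabilityMeasure_map hfm
  exact (hs (μ.map f) this).preimage ⟨hfm.measurable_mk, by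
    rw [← Measure.map_congr hfm.ae_eq_mk]⟩ |>.congr (by
      filter_upwards [hfm.ae_eq_mk] with x hx
      exact propext (by simp [hx] : _ ∈ _ ↔ _ ∈ _) )

/-! ### Measurable selection by least norm. -/

section Selection

open Filter Topology Set
open scoped NNReal

variable {Y : Type*} [MeasurableSpace Y] {J : Type*}

/-- By compactness, an exact solution exists iff approximate ones exist for every tolerance; by the
Lipschitz bound, uniform in `j`, approximate solutions can be sought in a countable dense set. The
index set `J` may thus be uncountable. -/
theorem measurableSet_exists_mem_forall_le_zero {E : Type*} [PseudoMetricSpace E]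
    {V : Y → J → E → ℝ} {C : ℝ≥0} (hV : ∀ y j, LipschitzWith C (V y j))
    (hm : ∀ e c, MeasurableSet {y | ∀ j, V y j e ≤ c}) {F : Set E} (hF : IsCompact F) :
    MeasurableSet {y | ∃ e ∈ F, ∀ j, V y j e ≤ 0} := by
  obtain ⟨D, hDF, hD, hFD⟩ := hF.isSeparable.exists_countable_dense_subset
  have h : {y | ∃ e ∈ F, ∀ j, V y j e ≤ 0} =
      ⋂ n : ℕ, ⋃ d ∈ D, {y | ∀ j, V y j d ≤ 1 / ((n : ℝ) + 1)} := by
    ext y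
    simp only [mem_ofPred_eq, mem_iInter, mem_iUnion, exists_prop]
    constructor
    · rintro ⟨e, he, hej⟩ n
      -- Dividing by `C + 1` rather than `C` covers `C = 0`.
      have hpos : 0 < 1 / ((n : ℝ) + 1) / (C + 1) := by positivity
      obtain ⟨d, hd, hde⟩ := Metric.mem_closure_iff.1 (hFD he) _ hpos
      refine ⟨d, hd, fun j => ?_⟩
      have h1 := (le_abs_self _).trans ((hV y j).dist_le_mul d e)
      rw [lt_div_iff₀ (by positivity), dist_comm] at hde
      nlinarith [hej j, dist_nonneg (x := d) (y := e)]
    · intro h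
      choose d hd hdj using h
      obtain ⟨e, he, φ, hφ, hlim⟩ := hF.tendsto_subseq fun n => hDF (hd n)
      refine ⟨e, he, fun j => ?_⟩
      have h1 := ((hV y j).continuous.tendsto e).comp hlim
      have h2 : Tendsto (fun n : ℕ => 1 / ((φ n : ℝ) + 1)) atTop (𝓝 0) :=
        tendsto_one_div_add_atTop_nhds_zero_nat.comp hφ.tendsto_atTop
      exact le_of_tendsto_of_tendsto' h1 h2 fun n => hdj (φ n) j
  rw [h]
  exact .iInter fun n => .biUnion hD fun d _ => hm d _

/-- A measurable selection of a correspondence with nonempty compact convex values: the point of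
least norm. -/
theorem exists_measurable_selection {E : Type*} [NormedAddCommGroup E] [NormedSpace ℝ E]
    [StrictConvexSpace ℝ E] [MeasurableSpace E] [BorelSpace E]
    {V : Y → J → E → ℝ} {C : ℝ≥0} (hV : ∀ y j, LipschitzWith C (V y j))
    (hm : ∀ e c, MeasurableSet {y | ∀ j, V y j e ≤ c}) {F : Set E} (hF : IsCompact F)
    (hconv : ∀ y, Convex ℝ {e | e ∈ F ∧ ∀ j, V y j e ≤ 0})
    (hne : ∀ y, ∃ e ∈ F, ∀ j, V y j e ≤ 0) :
    ∃ s : Y → E, Measurable s ∧ ∀ y, s y ∈ F ∧ ∀ j, V y j (s y) ≤ 0 := by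
  have hmin : ∀ y, ∃ e ∈ {e | e ∈ F ∧ ∀ j, V y j e ≤ 0},
      IsMinOn (fun e => ‖e‖) {e | e ∈ F ∧ ∀ j, V y j e ≤ 0} e := by
    intro y
    have hc : IsClosed {e | ∀ j, V y j e ≤ 0} := by
      simp only [ofPred_forall]
      exact isClosed_iInter fun j => isClosed_le (hV y j).continuous continuous_const
    obtain ⟨e, he, hej⟩ := hne y
    exact (hF.inter_right hc).exists_isMinOn ⟨e, he, hej⟩ continuous_norm.continuousOn
  choose s hs hsmin using hmin
  have huniq : ∀ y e, e ∈ F → (∀ j, V y j e ≤ 0) → ‖e‖ ≤ ‖s y‖ → e = s y := by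
    intro y e he hej hle
    have heq : ‖e‖ = ‖s y‖ := le_antisymm hle (hsmin y ⟨he, hej⟩)
    by_contra hne
    -- Strict convexity: the midpoint of two distinct minimizers would have smaller norm.
    have hlt := (norm_midpoint_lt_iff heq).2 hne
    have hmem := hconv y ⟨he, hej⟩ (hs y) (by norm_num : (0 : ℝ) ≤ 1 / 2)
      (by norm_num : (0 : ℝ) ≤ 1 / 2) (by norm_num)
    rw [← smul_add] at hmem
    have := hsmin y hmem
    simp only [mem_ofPred_eq] at this
    linarith
  have hv : Measurable fun y => ‖s y‖ := by
    refine measurable_of_Iic fun c => ?_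
    have : (fun y => ‖s y‖) ⁻¹' Iic c =
        {y | ∃ e ∈ F ∩ Metric.closedBall 0 c, ∀ j, V y j e ≤ 0} := by
      ext y
      simp only [mem_preimage, mem_Iic, mem_ofPred_eq, mem_inter_iff, mem_closedBall_zero_iff]
      constructor
      · exact fun h => ⟨s y, ⟨(hs y).1, h⟩, (hs y).2⟩
      · rintro ⟨e, ⟨he, hec⟩, hej⟩
        exact (hsmin y ⟨he, hej⟩).trans hec
    rw [this]
    exact measurableSet_exists_mem_forall_le_zero hV hm (hF.inter_right Metric.isClosed_closedBall)
  refine ⟨s, measurable_of_isClosed fun G hG => ?_, hs⟩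
  -- The extra constraint `‖e‖ ≤ ‖s y‖` leaves `s y` as the only solution, so `s y ∈ G` becomes a
  -- solvability statement over `F ∩ G`.
  let V' : Y → Option J → E → ℝ := fun y j e => j.elim (‖e‖ - ‖s y‖) fun j => V y j e
  have hV' : ∀ y j, LipschitzWith (max C 1) (V' y j) := by
    rintro y (_ | j)
    · refine (LipschitzWith.of_dist_le_mul fun a b => ?_ : LipschitzWith 1 _).weaken
        (le_max_right _ _)
      simpa [V', Real.dist_eq, dist_eq_norm] using abs_norm_sub_norm_le a b
    · exact (hV y j).weaken (le_max_left _ _)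
  have hm' : ∀ e c, MeasurableSet {y | ∀ j, V' y j e ≤ c} := by
    intro e c
    simp only [Option.forall, ofPred_and]
    exact (measurableSet_le (measurable_const.sub hv) measurable_const).inter (hm e c)
  have : s ⁻¹' G = {y | ∃ e ∈ F ∩ G, ∀ j, V' y j e ≤ 0} := by
    ext y
    simp only [mem_preimage, mem_ofPred_eq, Option.forall]
    constructor
    · exact fun h => ⟨s y, ⟨(hs y).1, h⟩, by simp [V'], (hs y).2⟩
    · rintro ⟨e, ⟨he, heG⟩, hle, hej⟩
      rwa [← huniq y e he hej (by simpa [V'] using hle)]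
  rw [this]
  exact measurableSet_exists_mem_forall_le_zero hV' hm' (hF.inter_right hG)

end Selection

/-! ### Stochastic dominance on a finite chain. -/

section FiniteScores

variable {S : Finset ℝ}

theorem SDLE.trans {μ ν ρ : Measure S} (h₁ : SDLE μ ν) (h₂ : SDLE ν ρ) : SDLE μ ρ :=
  fun x => (h₂ x).trans (h₁ x)

/-- A nonempty lower set in a finite chain is the initial segment below its maximum. -/
theorem SDLE.measure_isLowerSet_le {μ ν : Measure S} (h : SDLE μ ν) {A : Set S}
    (hA : IsLowerSet A) : ν A ≤ μ A := by
  rcases A.eq_empty_or_nonempty with rfl | hne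
  · simp
  obtain ⟨a, ha, hmax⟩ := A.toFinite.exists_maximal hne
  have : A = {s : S | (s : ℝ) ≤ a} := by
    ext s
    refine ⟨fun hs => ?_, fun hs => hA hs ha⟩
    rcases le_total s a with h | h
    · exact h
    · exact hmax hs h
  rw [this]
  exact h a

theorem SDLE.of_forall_mem {μ ν : Measure S}
    (h : ∀ y : S, ν {s : S | (s : ℝ) ≤ y} ≤ μ {s : S | (s : ℝ) ≤ y}) : SDLE μ ν := by
  intro x
  rcases {s : S | (s : ℝ) ≤ x}.eq_empty_or_nonempty with he | hne
  · simp [he]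
  obtain ⟨a, ha, hmax⟩ := (Set.toFinite {s : S | (s : ℝ) ≤ x}).exists_maximal hne
  have : {s : S | (s : ℝ) ≤ x} = {s : S | (s : ℝ) ≤ a} := by
    ext s
    refine ⟨fun hs => ?_, fun hs => le_trans (Subtype.coe_le_coe.2 hs) ha⟩
    rcases le_total s a with h | h
    · exact h
    · exact hmax hs h
  rw [this]
  exact h a

/-- Layer-cake formula: superlevel sets of an antitone function are lower sets. -/
theorem SDLE.lintegral_le {μ ν : Measure S} (h : SDLE μ ν) {φ : S → ℝ≥0∞} (hφ : Antitone φ)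
    (hfin : ∀ s, φ s ≠ ∞) : ∫⁻ s, φ s ∂ν ≤ ∫⁻ s, φ s ∂μ := by
  have hlayer : ∀ ρ : Measure S, ∫⁻ s, φ s ∂ρ =
      ∫⁻ c in Set.Ioi (0 : ℝ), ρ {s | c < (φ s).toReal} := by
    intro ρ
    rw [← lintegral_eq_lintegral_meas_lt ρ (.of_forall fun s => ENNReal.toReal_nonneg)
      Measurable.of_discrete.aemeasurable]
    exact lintegral_congr fun s => (ENNReal.ofReal_toReal (hfin s)).symm
  rw [hlayer, hlayer]
  refine lintegral_mono fun c => h.measure_isLowerSet_le fun a b hba (ha : c < _) => ?_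
  exact ha.trans_le (ENNReal.toReal_mono (hfin b) (hφ hba))

/-- Monotonicity of `κ` makes `s ↦ κ s (-∞, x]` antitone. This is what keeps underperformance
feasible after conversion. -/
theorem SDLE.bind_mono {μ ν : Measure S} (h : SDLE μ ν) {κ : S → Measure S}
    [∀ s, IsProbabilityMeasure (κ s)] (hκ : ∀ r s : S, s < r → SDLE (κ s) (κ r)) :
    SDLE (μ.bind κ) (ν.bind κ) := by
  intro x
  rw [Measure.bind_apply .of_discrete Measurable.of_discrete.aemeasurable,
    Measure.bind_apply .of_discrete Measurable.of_discrete.aemeasurable]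
  refine h.lintegral_le (fun s r hsr => ?_) fun s => measure_ne_top _ _
  rcases hsr.eq_or_lt with rfl | hlt
  · rfl
  · exact hκ r s hlt x

/-- Mass at scores at most `x` stays there when each score moves only downward. -/
theorem sdle_bind_self {μ : Measure S} {κ : S → Measure S}
    (hκ : ∀ s, κ s (Set.Iic s) = 1) : SDLE (μ.bind κ) μ := by
  intro x
  rw [Measure.bind_apply .of_discrete Measurable.of_discrete.aemeasurable,
    ← lintegral_indicator_one .of_discrete]
  refine lintegral_mono fun s => ?_
  by_cases hs : (s : ℝ) ≤ x
  · rw [Set.indicator_of_mem (by exact hs), Pi.one_apply, ← hκ s]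
    exact measure_mono fun r (hr : r ≤ s) => le_trans (Subtype.coe_le_coe.2 hr) hs
  · rw [Set.indicator_of_notMem (by exact hs)]
    exact zero_le

namespace MarkovTransition

/-- The transition `Y × S → Δ(S)` with a given matrix of weights at each point of `Y`. -/
noncomputable def ofWeights {Y : Type*} [MeasurableSpace Y] (w : Y → S → S → ℝ≥0∞)
    (hw : ∀ s s', Measurable[universalCompletion Y] fun y => w y s s')
    (hsum : ∀ y s, ∑ s', w y s s' = 1) : MarkovTransition (Y × S) S where
  toFun q := ∑ s', w q.1 q.2 s' • Measure.dirac s'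
  isProbabilityMeasure q := ⟨by simpa using hsum q.1 q.2⟩
  measurable_apply B hB := by
    have h : (fun q : Y × S => (∑ s', w q.1 q.2 s' • Measure.dirac s') B) =
        fun q => ∑ s', ∑ s, Set.indicator {q : Y × S | q.2 = s}
          (fun q => w q.1 s s' * B.indicator 1 s') q := by
      ext q
      simp only [Measure.coe_finsetSum, Measure.coe_smul, Finset.sum_apply, Pi.smul_apply,
        Measure.dirac_apply' _ hB, smul_eq_mul]
      refine Finset.sum_congr rfl fun s' _ => ?_
      rw [Finset.sum_eq_single q.2]
      · simp
      · intro s _ hs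
        exact Set.indicator_of_notMem (s := {q : Y × S | q.2 = s}) (fun h => hs (Eq.symm h)) _
      · simp
    rw [h]
    refine Finset.measurable_sum _ fun s' _ => Finset.measurable_sum _ fun s _ => ?_
    refine Measurable.indicator ?_ ?_
    · exact ((hw s s').comp (measurable_universalCompletion measurable_fst)).mul_const _
    · exact le_universalCompletion _ (measurable_snd (measurableSet_singleton s))

theorem ofWeights_singleton {Y : Type*} [MeasurableSpace Y] {w : Y → S → S → ℝ≥0∞}
    (hw : ∀ s s', Measurable[universalCompletion Y] fun y => w y s s')
    (hsum : ∀ y s, ∑ s', w y s s' = 1) (y : Y) (s s' : S) :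
    ofWeights w hw hsum (y, s) {s'} = w y s s' := by
  change (∑ r, w y s r • Measure.dirac r) {s'} = _
  simp [Set.indicator_apply]

end MarkovTransition

/-! ### The monotone coupling -/

section Coupling

open Set

/-- The interval of quantiles `(μ(-∞, s), μ(-∞, s]]` at which the quantile function of `μ` takes
the value `s`. -/
def quantileInterval (μ : Measure S) (s : S) : Set ℝ := Ioc (μ.real (Iio s)) (μ.real (Iic s))

theorem measurableSet_quantileInterval (μ : Measure S) (s : S) :
    MeasurableSet (quantileInterval μ s) := measurableSet_Ioc

theorem volume_quantileInterval (μ : Measure S) [IsProbabilityMeasure μ] (s : S) :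
    volume (quantileInterval μ s) = μ {s} := by
  rw [quantileInterval, Real.volume_Ioc, ← measureReal_sdiff Iio_subset_Iic_self .of_discrete,
    Iic_sdiff_Iio, Icc_self, ofReal_measureReal]

theorem pairwise_disjoint_quantileInterval (μ : Measure S) [IsProbabilityMeasure μ] :
    Pairwise (Function.onFun Disjoint (quantileInterval μ)) := by
  have key : ∀ s r : S, s < r → Disjoint (quantileInterval μ s) (quantileInterval μ r) := by
    intro s r hsr
    refine Set.disjoint_left.2 fun x hx hx' => ?_
    have : μ.real (Iic s) ≤ μ.real (Iio r) := measureReal_mono fun a (ha : a ≤ s) => ha.trans_lt hsr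
    exact (hx.2.trans this).not_gt hx'.1
  intro s r hsr
  rcases hsr.lt_or_gt with h | h
  · exact key s r h
  · exact (key r s h).symm

theorem iUnion_quantileInterval (μ : Measure S) [IsProbabilityMeasure μ] :
    ⋃ s, quantileInterval μ s = Ioc 0 1 := by
  refine Subset.antisymm (iUnion_subset fun s => Ioc_subset_Ioc measureReal_nonneg
    measureReal_le_one) fun x hx => mem_iUnion.2 ?_
  have hne : Nonempty S := by
    by_contra h
    rw [not_nonempty_iff] at h
    exact IsProbabilityMeasure.ne_zero μ (Measure.eq_zero_of_isEmpty μ)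
  have hA : {s : S | x ≤ μ.real (Iic s)}.Nonempty := by
    obtain ⟨a, ha⟩ := Finite.exists_max (fun s : S => s)
    refine ⟨a, ?_⟩
    have : Iic a = univ := eq_univ_of_forall ha
    simpa [this] using hx.2
  obtain ⟨s, hs, hmin⟩ := (toFinite {s : S | x ≤ μ.real (Iic s)}).exists_minimal hA
  -- The least `s` with `x ≤ F(s)` is the `x`-quantile; strictness on the left comes from the
  -- predecessor of `s`, if there is one.
  refine ⟨s, ?_, hs⟩
  rcases (Iio s).eq_empty_or_nonempty with he | hne
  · simpa [he] using hx.1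
  obtain ⟨r, hr, hmax⟩ := (toFinite (Iio s)).exists_maximal hne
  have hIio : Iio s = Iic r := by
    ext a
    refine ⟨fun ha => ?_, fun ha => lt_of_le_of_lt (mem_Iic.1 ha) (mem_Iio.1 hr)⟩
    rcases le_total a r with h | h
    · exact h
    · exact hmax ha h
  rw [hIio]
  by_contra hcon
  rw [not_lt] at hcon
  exact (hmin hcon (le_of_lt hr)).not_gt hr

/-- The quantile intervals of `ν` tile `(0, 1]` and so partition each interval of `μ`. -/
theorem sum_volume_quantileInterval_inter (μ ν : Measure S) [IsProbabilityMeasure μ]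
    [IsProbabilityMeasure ν] (s : S) :
    ∑ s', volume (quantileInterval μ s ∩ quantileInterval ν s') = μ {s} := by
  rw [← tsum_fintype (L := .unconditional S), ← measure_iUnion
      (fun a b hab => (pairwise_disjoint_quantileInterval ν hab).mono inter_subset_right
        inter_subset_right) (fun s' => (measurableSet_quantileInterval μ s).inter
        (measurableSet_quantileInterval ν s')),
    ← inter_iUnion, iUnion_quantileInterval, inter_eq_left.2, volume_quantileInterval]
  rw [← iUnion_quantileInterval μ]
  exact subset_iUnion _ s

/-- Dominance orders the quantile functions: at each level the quantile of `ν` is at most that of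
`μ`. -/
theorem SDLE.quantileInterval_inter_eq_empty {μ ν : Measure S} [IsProbabilityMeasure μ]
    [IsProbabilityMeasure ν] (h : SDLE ν μ) {s s' : S} (hs : s < s') :
    quantileInterval μ s ∩ quantileInterval ν s' = ∅ := by
  refine Set.disjoint_iff_inter_eq_empty.1 (Set.disjoint_left.2 fun x hx hx' => ?_)
  have h1 : μ.real (Iic s) ≤ ν.real (Iic s) :=
    ENNReal.toReal_mono (measure_ne_top _ _) (h s)
  have h2 : ν.real (Iic s) ≤ ν.real (Iio s') :=
    measureReal_mono fun a (ha : a ≤ s) => ha.trans_lt hs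
  exact ((hx.2.trans h1).trans h2).not_gt hx'.1

open Classical in
/-- The conditional distribution of the second coordinate given the first in the monotone coupling
of `μ` and `ν`, as a matrix of weights. -/
noncomputable def couplingWeight (μ ν : Measure S) (s s' : S) : ℝ≥0∞ :=
  if μ {s} = 0 then if s' = s then 1 else 0
  else volume (quantileInterval μ s ∩ quantileInterval ν s') / μ {s}

theorem sum_couplingWeight (μ ν : Measure S) [IsProbabilityMeasure μ]
    [IsProbabilityMeasure ν] (s : S) : ∑ s', couplingWeight μ ν s s' = 1 := by
  unfold couplingWeight
  split_ifs with h
  · simp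
  · simp_rw [div_eq_mul_inv]
    rw [← Finset.sum_mul, sum_volume_quantileInterval_inter,
      ENNReal.mul_inv_cancel h (measure_ne_top _ _)]

theorem sum_mul_couplingWeight (μ ν : Measure S) [IsProbabilityMeasure μ]
    [IsProbabilityMeasure ν] (s' : S) : ∑ s, μ {s} * couplingWeight μ ν s s' = ν {s'} := by
  rw [← sum_volume_quantileInterval_inter ν μ s']
  refine Finset.sum_congr rfl fun s _ => ?_
  rw [inter_comm]
  unfold couplingWeight
  split_ifs with h h'
  · rw [h, zero_mul, eq_comm]
    exact measure_mono_null inter_subset_left ((volume_quantileInterval μ s).trans h)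
  · rw [h, zero_mul, eq_comm]
    exact measure_mono_null inter_subset_left ((volume_quantileInterval μ s).trans h)
  · exact ENNReal.mul_div_cancel h (measure_ne_top _ _)

/-- At a null atom the row is the point mass at `s` by convention, which is also downward. -/
theorem SDLE.couplingWeight_eq_zero {μ ν : Measure S} [IsProbabilityMeasure μ]
    [IsProbabilityMeasure ν] (h : SDLE ν μ) {s s' : S} (hs : s < s') :
    couplingWeight μ ν s s' = 0 := by
  unfold couplingWeight
  rw [h.quantileInterval_inter_eq_empty hs]
  simp [hs.ne']

theorem measurable_couplingWeight {Y : Type*} [MeasurableSpace Y] {κ η : Y → Measure S}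
    (hκ : ∀ B, Measurable fun y => κ y B) (hη : ∀ B, Measurable fun y => η y B) (s s' : S) :
    Measurable fun y => couplingWeight (κ y) (η y) s s' := by
  unfold couplingWeight
  refine Measurable.ite (hκ _ (measurableSet_singleton 0)) measurable_const ?_
  refine Measurable.div ?_ (hκ _)
  simp_rw [quantileInterval, Ioc_inter_Ioc, Real.volume_Ioc]
  have h1 := fun B => (hκ B).ennreal_toReal
  have h2 := fun B => (hη B).ennreal_toReal
  exact (((h1 _).min (h2 _)).sub ((h1 _).max (h2 _))).ennreal_ofReal

/-- A measurable family of distributions dominated by another one is obtained from it by a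
measurable family of downward transitions. -/
theorem exists_downward_transition {Y : Type*} [MeasurableSpace Y] (κ η : MarkovTransition Y S)
    (h : ∀ y, SDLE (η y) (κ y)) :
    ∃ H : MarkovTransition (Y × S) S, ∀ y, (κ y).bind (fun s => H (y, s)) = η y ∧
      ∀ s, H (y, s) (Iic s) = 1 := by
  have hw : ∀ s s', Measurable[universalCompletion Y]
      fun y => couplingWeight (κ y) (η y) s s' := fun s s' =>
    @measurable_couplingWeight S Y (universalCompletion Y) κ η
      (fun B => κ.measurable_apply B .of_discrete) (fun B => η.measurable_apply B .of_discrete) s s'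
  refine ⟨.ofWeights _ hw fun y s => sum_couplingWeight _ _ _, fun y => ⟨?_, fun s => ?_⟩⟩
  · refine Measure.ext_of_singleton fun s' => ?_
    rw [Measure.bind_apply .of_discrete Measurable.of_discrete.aemeasurable, lintegral_fintype]
    simp_rw [MarkovTransition.ofWeights_singleton, mul_comm _ ((κ y) _)]
    exact sum_mul_couplingWeight _ _ _
  · rw [prob_compl_eq_zero_iff .of_discrete |>.symm, compl_Iic,
      ← Set.biUnion_of_singleton (Ioi s), measure_biUnion_null_iff (Set.to_countable _)]
    intro s' hs'
    rw [MarkovTransition.ofWeights_singleton]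
    exact (h y).couplingWeight_eq_zero hs'

end Coupling

end FiniteScores

/-! ### Monotone stochastic matrices as a compact convex set. -/

section MonotoneMatrices

variable {S : Finset ℝ}

open Classical in
/-- The mass that row `s` of the matrix `e` gives to the set `A`. -/
noncomputable def rowMass (e : EuclideanSpace ℝ (S × S)) (s : S) (A : Set S) : ℝ :=
  ∑ s' with s' ∈ A, e (s, s')

/-- The mass that the product of the row vector `μ` and the matrix `e` gives to the set `A`. -/
noncomputable def pushMass (μ : Measure S) (e : EuclideanSpace ℝ (S × S)) (A : Set S) : ℝ :=
  ∑ s, μ.real {s} * rowMass e s A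

theorem rowMass_combo (a b : ℝ) (e e' : EuclideanSpace ℝ (S × S)) (s : S) (A : Set S) :
    rowMass (a • e + b • e') s A = a * rowMass e s A + b * rowMass e' s A := by
  simp [rowMass, Finset.sum_add_distrib, Finset.mul_sum]

theorem pushMass_combo (μ : Measure S) (a b : ℝ) (e e' : EuclideanSpace ℝ (S × S)) (A : Set S) :
    pushMass μ (a • e + b • e') A = a * pushMass μ e A + b * pushMass μ e' A := by
  simp only [pushMass, rowMass_combo, Finset.mul_sum, ← Finset.sum_add_distrib]
  exact Finset.sum_congr rfl fun s _ => by ring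

@[fun_prop]
theorem continuous_rowMass (s : S) (A : Set S) :
    Continuous fun e : EuclideanSpace ℝ (S × S) => rowMass e s A := by
  unfold rowMass
  fun_prop

theorem abs_rowMass_sub_le (e e' : EuclideanSpace ℝ (S × S)) (s : S) (A : Set S) :
    |rowMass e s A - rowMass e' s A| ≤ S.card * dist e e' := by
  classical
  unfold rowMass
  rw [← Finset.sum_sub_distrib]
  calc |∑ s' with s' ∈ A, (e (s, s') - e' (s, s'))|
      ≤ ∑ s' with s' ∈ A, |e (s, s') - e' (s, s')| := Finset.abs_sum_le_sum_abs _ _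
    _ ≤ ∑ s' : S, |e (s, s') - e' (s, s')| :=
        Finset.sum_le_sum_of_subset_of_nonneg (Finset.filter_subset _ _) fun _ _ _ => abs_nonneg _
    _ ≤ ∑ _s' : S, dist e e' := by
        refine Finset.sum_le_sum fun s' _ => ?_
        rw [dist_eq_norm]
        exact PiLp.norm_apply_le (e - e') (s, s')
    _ = S.card * dist e e' := by simp

/-- The constant does not depend on `μ`, as the selection argument requires. -/
theorem lipschitzWith_pushMass (μ : Measure S) [IsProbabilityMeasure μ] (A : Set S) :
    LipschitzWith S.card fun e => pushMass μ e A := by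
  refine LipschitzWith.of_dist_le_mul fun e e' => ?_
  rw [Real.dist_eq, pushMass, pushMass, ← Finset.sum_sub_distrib]
  calc |∑ s, (μ.real {s} * rowMass e s A - μ.real {s} * rowMass e' s A)|
      ≤ ∑ s, |μ.real {s} * rowMass e s A - μ.real {s} * rowMass e' s A| :=
        Finset.abs_sum_le_sum_abs _ _
    _ ≤ ∑ s, μ.real {s} * (S.card * dist e e') := by
        refine Finset.sum_le_sum fun s _ => ?_
        rw [← mul_sub, abs_mul, abs_of_nonneg measureReal_nonneg]
        exact mul_le_mul_of_nonneg_left (abs_rowMass_sub_le e e' s A) measureReal_nonneg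
    _ = _ := by
        rw [← Finset.sum_mul, sum_measureReal_singleton]
        simp

/-- The matrix of a family of measures. -/
noncomputable def toMatrix (κ : S → Measure S) : EuclideanSpace ℝ (S × S) :=
  WithLp.toLp 2 fun i => (κ i.1).real {i.2}

theorem rowMass_toMatrix (κ : S → Measure S) [∀ s, IsProbabilityMeasure (κ s)] (s : S)
    (A : Set S) : rowMass (toMatrix κ) s A = (κ s).real A := by
  classical
  simp only [rowMass, toMatrix]
  rw [sum_measureReal_singleton]
  simp

theorem pushMass_toMatrix (μ : Measure S) [IsProbabilityMeasure μ] (κ : S → Measure S)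
    [∀ s, IsProbabilityMeasure (κ s)] (A : Set S) :
    pushMass μ (toMatrix κ) A = (μ.bind κ).real A := by
  rw [measureReal_def, Measure.bind_apply .of_discrete Measurable.of_discrete.aemeasurable,
    lintegral_fintype, ENNReal.toReal_sum fun s _ => by finiteness]
  refine Finset.sum_congr rfl fun s _ => ?_
  rw [rowMass_toMatrix, ENNReal.toReal_mul, mul_comm]
  rfl

variable (S) in
/-- The monotone stochastic matrices. -/
def monotoneMatrices : Set (EuclideanSpace ℝ (S × S)) :=
  {e | (∀ i, 0 ≤ e i) ∧ (∀ s, rowMass e s Set.univ = 1) ∧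
    ∀ s r, s < r → ∀ y, rowMass e r (Set.Iic y) ≤ rowMass e s (Set.Iic y)}

variable (S) in
theorem isCompact_monotoneMatrices : IsCompact (monotoneMatrices S) := by
  classical
  have hc : IsClosed (monotoneMatrices S) := by
    simp only [monotoneMatrices, Set.ofPred_and, Set.ofPred_forall]
    refine .inter (isClosed_iInter fun i => isClosed_le (by fun_prop) (by fun_prop))
      (.inter (isClosed_iInter fun s => isClosed_eq (by fun_prop) (by fun_prop)) ?_)
    exact isClosed_iInter fun s => isClosed_iInter fun r => isClosed_iInter fun _ =>
      isClosed_iInter fun y => isClosed_le (by fun_prop) (by fun_prop)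
  -- Nonnegative entries with row sums one lie in `[0, 1]`, so the set sits in a compact cube.
  refine (((isCompact_univ_pi fun _ : S × S => isCompact_Icc (a := (0 : ℝ)) (b := 1)).image
    (PiLp.continuous_toLp 2 _)).of_isClosed_subset hc ?_)
  rintro e ⟨h0, h1, -⟩
  refine ⟨e.ofLp, fun i _ => ⟨h0 i, ?_⟩, rfl⟩
  rw [← h1 i.1, rowMass]
  exact Finset.single_le_sum (f := fun s' => e (i.1, s')) (fun s' _ => h0 _) (by simp)

variable (S) in
theorem convex_monotoneMatrices : Convex ℝ (monotoneMatrices S) := by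
  rintro e ⟨h0, h1, h2⟩ e' ⟨h0', h1', h2'⟩ a b ha hb hab
  refine ⟨fun i => ?_, fun s => ?_, fun s r hsr y => ?_⟩
  · exact add_nonneg (mul_nonneg ha (h0 i)) (mul_nonneg hb (h0' i))
  · rw [rowMass_combo, h1, h1', mul_one, mul_one, hab]
  · rw [rowMass_combo, rowMass_combo]
    exact add_le_add (mul_le_mul_of_nonneg_left (h2 s r hsr y) ha)
      (mul_le_mul_of_nonneg_left (h2' s r hsr y) hb)

theorem toMatrix_mem_monotoneMatrices {κ : S → Measure S} [∀ s, IsProbabilityMeasure (κ s)]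
    (h : ∀ r s : S, s < r → SDLE (κ s) (κ r)) : toMatrix κ ∈ monotoneMatrices S := by
  refine ⟨fun i => measureReal_nonneg, fun s => ?_, fun s r hsr y => ?_⟩
  · rw [rowMass_toMatrix]; simp
  · rw [rowMass_toMatrix, rowMass_toMatrix]
    exact ENNReal.toReal_mono (measure_ne_top _ _) (h r s hsr y)

theorem sdle_of_toMatrix_mem {κ : S → Measure S} [∀ s, IsProbabilityMeasure (κ s)]
    (h : toMatrix κ ∈ monotoneMatrices S) {r s : S} (hsr : s < r) : SDLE (κ s) (κ r) := by
  refine SDLE.of_forall_mem fun y => ?_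
  have := h.2.2 s r hsr y
  rw [rowMass_toMatrix, rowMass_toMatrix] at this
  exact (ENNReal.toReal_le_toReal (measure_ne_top _ _) (measure_ne_top _ _)).1 this

theorem isProbabilityMeasure_bind (μ : Measure S) [IsProbabilityMeasure μ] (κ : S → Measure S)
    [∀ s, IsProbabilityMeasure (κ s)] : IsProbabilityMeasure (μ.bind κ) :=
  ⟨by rw [Measure.bind_apply .of_discrete Measurable.of_discrete.aemeasurable]; simp⟩

theorem sdle_bind_iff (μ ν : Measure S) [IsProbabilityMeasure μ] [IsProbabilityMeasure ν]
    (κ : S → Measure S) [∀ s, IsProbabilityMeasure (κ s)] :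
    SDLE (μ.bind κ) ν ↔
      ∀ y, ν.real (Set.Iic y) - pushMass μ (toMatrix κ) (Set.Iic y) ≤ 0 := by
  have := isProbabilityMeasure_bind μ κ
  simp only [sub_nonpos, pushMass_toMatrix]
  exact ⟨fun h y => ENNReal.toReal_mono (measure_ne_top _ _) (h y), fun h =>
    SDLE.of_forall_mem fun y =>
      (ENNReal.toReal_le_toReal (measure_ne_top _ _) (measure_ne_top _ _)).1 (h y)⟩

theorem bind_eq_iff (μ ν : Measure S) [IsProbabilityMeasure μ] [IsProbabilityMeasure ν]
    (κ : S → Measure S) [∀ s, IsProbabilityMeasure (κ s)] :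
    μ.bind κ = ν ↔ ∀ s, pushMass μ (toMatrix κ) {s} = ν.real {s} := by
  have := isProbabilityMeasure_bind μ κ
  simp only [pushMass_toMatrix]
  exact ⟨fun h s => by rw [h], fun h => Measure.ext_of_singleton fun s =>
    (ENNReal.toReal_eq_toReal_iff' (measure_ne_top _ _) (measure_ne_top _ _)).1 (h s)⟩

end MonotoneMatrices

/-! ### Measurable choice of the discernment witnesses. -/

section DiscerningTransition

variable {Θ T : Type*} [MeasurableSpace Θ] [MeasurableSpace T] {S : Finset ℝ}

/-- The violations, at the matrix `e`, of the constraints that define `t θ` being more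
`θ`-discerning than `ψ`. -/
noncomputable def discernmentViolation (π : Kernel (T × Θ) S) (t : Θ → T) (y : Θ × T) :
    (Θ × S) ⊕ (S × Bool) → EuclideanSpace ℝ (S × S) → ℝ
  | .inl z, e => (π (y.2, z.1)).real (Set.Iic z.2) - pushMass (π (t y.1, z.1)) e (Set.Iic z.2)
  | .inr (s, true), e => pushMass (π (t y.1, y.1)) e {s} - (π (y.2, y.1)).real {s}
  | .inr (s, false), e => (π (y.2, y.1)).real {s} - pushMass (π (t y.1, y.1)) e {s}

theorem lipschitzWith_discernmentViolation (π : Kernel (T × Θ) S) [IsMarkovKernel π] (t : Θ → T)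
    (y : Θ × T) (j : (Θ × S) ⊕ (S × Bool)) :
    LipschitzWith S.card (discernmentViolation π t y j) := by
  rcases j with z | ⟨s, _ | _⟩ <;> refine LipschitzWith.of_dist_le_mul fun e e' => ?_ <;>
    simp only [discernmentViolation, dist_sub_left, dist_sub_right] <;>
    exact (lipschitzWith_pushMass _ _).dist_le_mul e e'

theorem discernmentViolation_combo (π : Kernel (T × Θ) S) (t : Θ → T)
    (y : Θ × T) (j : (Θ × S) ⊕ (S × Bool)) {a b : ℝ} (hab : a + b = 1)
    (e e' : EuclideanSpace ℝ (S × S)) :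
    discernmentViolation π t y j (a • e + b • e') =
      a * discernmentViolation π t y j e + b * discernmentViolation π t y j e' := by
  obtain rfl : b = 1 - a := by linarith
  rcases j with z | ⟨s, _ | _⟩ <;> simp only [discernmentViolation, pushMass_combo] <;> ring

theorem measurable_pushMass {Y : Type*} {_ : MeasurableSpace Y} {κ : Y → Measure S}
    (hκ : Measurable κ) (e : EuclideanSpace ℝ (S × S)) (A : Set S) :
    Measurable fun y => pushMass (κ y) e A :=
  Finset.measurable_sum _ fun s _ =>
    ((Measure.measurable_coe (measurableSet_singleton s)).comp hκ).ennreal_toReal.mul_const _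

theorem measurable_real_apply {Y : Type*} {_ : MeasurableSpace Y} {κ : Y → Measure S}
    (hκ : Measurable κ) (A : Set S) : Measurable fun y => (κ y).real A :=
  ((Measure.measurable_coe .of_discrete).comp hκ).ennreal_toReal

variable [TopologicalSpace Θ] [PolishSpace Θ] [BorelSpace Θ]
  [TopologicalSpace T] [PolishSpace T] [BorelSpace T]

/-- The inequalities range over uncountably many types, but depend on `(θ, ψ)` only through `(t θ,
ψ)`. The projection is therefore taken over `T × T`, where the data are Borel, and pulled back along
a universally measurable map. The remaining equalities are finitely many. -/
theorem measurableSet_discernmentViolation_le (π : Kernel (T × Θ) S) [IsMarkovKernel π] {t : Θ → T}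
    (ht : Measurable[universalCompletion Θ] t) (e : EuclideanSpace ℝ (S × S)) (c : ℝ) :
    MeasurableSet[universalCompletion (Θ × T)] {y | ∀ j, discernmentViolation π t y j e ≤ c} := by
  have ht' : Measurable[universalCompletion (Θ × T)] fun y : Θ × T => t y.1 :=
    ht.comp (measurable_universalCompletion measurable_fst)
  have h1 : MeasurableSet[universalCompletion (Θ × T)]
      {y | ∀ z, discernmentViolation π t y (.inl z) e ≤ c} := by
    have hg : Measurable[universalCompletion (Θ × T), universalCompletion (T × T)]
        fun y : Θ × T => (t y.1, y.2) :=
      measurable_universalCompletion_of_measurable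
        (ht'.prodMk (measurable_snd.mono le_universalCompletion le_rfl))
    let p : T × T → Θ × S → Prop := fun q z =>
      ¬ (π (q.2, z.1)).real (Set.Iic z.2) - pushMass (π (q.1, z.1)) e (Set.Iic z.2) ≤ c
    have hp : MeasurableSet {q : (T × T) × (Θ × S) | p q.1 q.2} := by
      have : {q : (T × T) × (Θ × S) | p q.1 q.2} = ⋃ s : S, {q | q.2.2 = s ∧
          ¬ (π (q.1.2, q.2.1)).real (Set.Iic s) - pushMass (π (q.1.1, q.2.1)) e (Set.Iic s) ≤ c} := by
        ext q; simp [p]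
      rw [this]
      refine .iUnion fun s => .inter
        ((measurable_snd.comp measurable_snd) (measurableSet_singleton s)) (.compl ?_)
      have hm : Measurable fun q : (T × T) × (Θ × S) =>
          (π (q.1.2, q.2.1)).real (Set.Iic s) - pushMass (π (q.1.1, q.2.1)) e (Set.Iic s) :=
        (measurable_real_apply (π.measurable.comp (by fun_prop)) _).sub
          (measurable_pushMass (π.measurable.comp (by fun_prop)) _ _)
      exact measurableSet_le hm measurable_const
    have := hg (measurableSet_universalCompletion_setOf_exists hp).compl
    convert this using 1
    ext y
    simp [p, discernmentViolation]
  have hπ1 : Measurable[universalCompletion (Θ × T)] fun y : Θ × T => π (t y.1, y.1) :=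
    π.measurable.comp (ht'.prodMk (measurable_fst.mono le_universalCompletion le_rfl))
  have hπ2 : Measurable[universalCompletion (Θ × T)] fun y : Θ × T => π (y.2, y.1) :=
    π.measurable.comp (measurable_swap.mono le_universalCompletion le_rfl)
  have h2 : MeasurableSet[universalCompletion (Θ × T)]
      {y | ∀ z, discernmentViolation π t y (.inr z) e ≤ c} := by
    rw [Set.ofPred_forall]
    refine .iInter ?_
    rintro ⟨s, _ | _⟩
    · exact ((measurable_real_apply hπ2 _).sub (measurable_pushMass hπ1 _ _)) measurableSet_Iic
    · exact ((measurable_pushMass hπ1 _ _).sub (measurable_real_apply hπ2 _)) measurableSet_Iic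
  simp only [Sum.forall, Set.ofPred_and]
  exact h1.inter h2

/-- If `t` is most discerning, the monotone transitions that witness it can be chosen in a
universally measurable way. -/
theorem IsMostDiscerning.exists_transition {π : Kernel (T × Θ) S} [IsMarkovKernel π] {t : Θ → T}
    (hmost : IsMostDiscerning π t) (ht : Measurable[universalCompletion Θ] t) :
    ∃ K : MarkovTransition ((Θ × T) × S) S, ∀ θ ψ,
      (∀ r s : S, s < r → SDLE (K ((θ, ψ), s)) (K ((θ, ψ), r))) ∧
      (∀ θ', SDLE ((π (t θ, θ')).bind fun s => K ((θ, ψ), s)) (π (ψ, θ'))) ∧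
      (π (t θ, θ)).bind (fun s => K ((θ, ψ), s)) = π (ψ, θ) := by
  obtain ⟨e, he, heK⟩ := @exists_measurable_selection (Θ × T) (universalCompletion _) _
    (EuclideanSpace ℝ (S × S)) _ _ _ _ _ (discernmentViolation π t) S.card
    (lipschitzWith_discernmentViolation π t) (measurableSet_discernmentViolation_le π ht)
    _ (isCompact_monotoneMatrices S) (by
      rintro y e ⟨he, hej⟩ e' ⟨he', hej'⟩ a b ha hb hab
      refine ⟨convex_monotoneMatrices S he he' ha hb hab, fun j => ?_⟩
      rw [discernmentViolation_combo π t y j hab]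
      exact add_nonpos (mul_nonpos_of_nonneg_of_nonpos ha (hej j))
        (mul_nonpos_of_nonneg_of_nonpos hb (hej' j))) (by
      rintro ⟨θ, ψ⟩
      obtain ⟨k, hk, hmono, heq, hle⟩ := hmost θ ψ
      refine ⟨toMatrix k, toMatrix_mem_monotoneMatrices hmono, ?_⟩
      rintro (⟨θ', y⟩ | ⟨s, _ | _⟩)
      · refine (sdle_bind_iff _ _ _).1 ?_ y
        -- The selection imposes the inequality at `θ' = θ` too, where it follows from the equality.
        by_cases h : θ' = θ
        · rw [h]
          exact fun x => (congrArg (fun μ : Measure S => μ _) heq).ge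
        · exact hle θ' h
      · exact sub_nonpos.2 ((bind_eq_iff _ _ _).1 heq s).ge
      · exact sub_nonpos.2 ((bind_eq_iff _ _ _).1 heq s).le)
  let w : Θ × T → S → S → ℝ≥0∞ := fun y s s' => ENNReal.ofReal (e y (s, s'))
  have hw : ∀ s s', Measurable[universalCompletion (Θ × T)] fun y => w y s s' := fun s s' =>
    ((by fun_prop : Measurable fun a : EuclideanSpace ℝ (S × S) => a (s, s')).comp
      he).ennreal_ofReal
  have hsum : ∀ y s, ∑ s', w y s s' = 1 := by
    intro y s
    rw [← ENNReal.ofReal_sum_of_nonneg fun s' _ => (heK y).1.1 (s, s')]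
    have := (heK y).1.2.1 s
    simp only [rowMass, Set.mem_univ, Finset.filter_true] at this
    rw [this, ENNReal.ofReal_one]
  let K := MarkovTransition.ofWeights w hw hsum
  have hmat : ∀ y, toMatrix (fun s => K (y, s)) = e y := by
    intro y
    ext i
    simp only [toMatrix, measureReal_def, K, MarkovTransition.ofWeights_singleton, w]
    exact ENNReal.toReal_ofReal ((heK y).1.1 i)
  refine ⟨K, fun θ ψ => ⟨fun r s hsr => ?_, fun θ' => ?_, ?_⟩⟩
  · exact sdle_of_toMatrix_mem (κ := fun s => K ((θ, ψ), s)) (by rw [hmat]; exact (heK _).1) hsr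
  · rw [sdle_bind_iff, hmat]
    exact fun y => (heK (θ, ψ)).2 (.inl (θ', y))
  · rw [bind_eq_iff, hmat]
    exact fun s => le_antisymm (sub_nonpos.1 ((heK (θ, ψ)).2 (.inr (s, true))))
      (sub_nonpos.1 ((heK (θ, ψ)).2 (.inr (s, false))))

end DiscerningTransition

/-! ### Integration and disintegration for universally measurable transitions. -/

namespace MarkovTransition

variable {X Y Z : Type*} [MeasurableSpace X] [MeasurableSpace Y] [MeasurableSpace Z]

/-- The transition `x ↦ k (f x)`, for a universally measurable `f`. -/
def comapUniversal (k : MarkovTransition Y Z) (f : X → Y)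
    (hf : Measurable[universalCompletion X, universalCompletion Y] f) : MarkovTransition X Z where
  toFun x := k (f x)
  isProbabilityMeasure _ := inferInstance
  measurable_apply B hB := (k.measurable_apply B hB).comp hf

/-- The composition `x ↦ ∫ k(x, dy) l((x, y), ·)`. -/
noncomputable def kcomp (k : MarkovTransition X Y) (l : MarkovTransition (X × Y) Z) :
    MarkovTransition X Z where
  toFun x := (l.comap (Prod.mk x) measurable_prodMk_left).act (k x)
  isProbabilityMeasure _ := inferInstance
  measurable_apply C hC := by
    simp_rw [act_apply _ _ hC]
    exact k.measurable_lintegral (l.measurable_apply C hC)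

theorem kcomp_apply (k : MarkovTransition X Y) (l : MarkovTransition (X × Y) Z) (x : X)
    {C : Set Z} (hC : MeasurableSet C) : k.kcomp l x C = ∫⁻ y, l (x, y) C ∂(k x) :=
  act_apply _ _ hC

open Classical in
/-- The transition that agrees with `k` on `A` and with `l` off `A`. -/
noncomputable def piecewise (A : Set X) (hA : MeasurableSet A) (k l : MarkovTransition X Y) :
    MarkovTransition X Y where
  toFun x := if x ∈ A then k x else l x
  isProbabilityMeasure x := by split_ifs <;> infer_instance
  measurable_apply B hB := by
    have : (fun x => (if x ∈ A then k x else l x) B) = fun x => if x ∈ A then k x B else l x B := by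
      ext x; split_ifs <;> rfl
    rw [this]
    exact Measurable.ite (le_universalCompletion _ hA) (k.measurable_apply B hB)
      (l.measurable_apply B hB)

theorem piecewise_of_mem {A : Set X} (hA : MeasurableSet A) (k l : MarkovTransition X Y) {x : X}
    (hx : x ∈ A) : piecewise A hA k l x = k x := if_pos hx

theorem piecewise_of_notMem {A : Set X} (hA : MeasurableSet A) (k l : MarkovTransition X Y)
    {x : X} (hx : x ∉ A) : piecewise A hA k l x = l x := if_neg hx

theorem ext_apply {k l : MarkovTransition X Y}
    (h : ∀ x B, MeasurableSet B → k x B = l x B) : k = l := by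
  have : k.toFun = l.toFun := funext fun x => Measure.ext (h x)
  cases k
  cases l
  simp_all

theorem measurable_lintegral_right (k : MarkovTransition X Y) {h : Y → ℝ≥0∞}
    (hh : Measurable[universalCompletion Y] h) :
    Measurable[universalCompletion X] fun x => ∫⁻ y, h y ∂(k x) :=
  k.measurable_lintegral (h := fun q => h q.2)
    (hh.comp (measurable_universalCompletion measurable_snd))

theorem lintegral_act_of_measurable (k : MarkovTransition X Y) (μ : Measure X)
    [IsProbabilityMeasure μ] {h : Y → ℝ≥0∞} (hh : Measurable h) :
    ∫⁻ y, h y ∂(k.act μ) = ∫⁻ x, ∫⁻ y, h y ∂(k x) ∂μ := by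
  have hae : ∀ f : Y → ℝ≥0∞, Measurable f → AEMeasurable (fun x => ∫⁻ y, f y ∂(k x)) μ :=
    fun f hf => aemeasurable_of_universal
      (k.measurable_lintegral_right (hf.mono le_universalCompletion le_rfl)) μ
  refine Measurable.ennreal_induction (motive := fun h => ∫⁻ y, h y ∂(k.act μ) =
    ∫⁻ x, ∫⁻ y, h y ∂(k x) ∂μ) (fun c s hs => ?_) (fun f g _ hf hg ihf ihg => ?_)
    (fun f hf hmono ih => ?_) hh
  · simp_rw [lintegral_indicator_const hs, act_apply _ _ hs]
    rw [lintegral_const_mul'' _ (aemeasurable_of_universal (k.measurable_apply s hs) μ)]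
  · simp only [Pi.add_apply]
    simp_rw [lintegral_add_left hf]
    rw [ihf, ihg, lintegral_add_left' (hae f hf)]
  · simp_rw [lintegral_iSup hf hmono]
    rw [lintegral_iSup' (fun n => hae _ (hf n))
      (.of_forall fun x i j hij => lintegral_mono (hmono hij))]
    exact iSup_congr ih

theorem lintegral_act (k : MarkovTransition X Y) (μ : Measure X) [IsProbabilityMeasure μ]
    {h : Y → ℝ≥0∞} (hh : Measurable[universalCompletion Y] h) :
    ∫⁻ y, h y ∂(k.act μ) = ∫⁻ x, ∫⁻ y, h y ∂(k x) ∂μ := by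
  obtain ⟨h', hm, hae⟩ := aemeasurable_of_universal hh (k.act μ)
  rw [lintegral_congr_ae hae, lintegral_act_of_measurable k μ hm]
  -- A null set of `k.act μ` is null for `k x` at `μ`-almost every `x`.
  obtain ⟨N, hsub, hN, hN0⟩ := exists_measurable_superset_of_null (ae_iff.1 hae)
  rw [act_apply _ _ hN, lintegral_eq_zero_iff'
    (aemeasurable_of_universal (k.measurable_apply N hN) μ)] at hN0
  refine lintegral_congr_ae (hN0.mono fun x hx => lintegral_congr_ae ?_)
  exact measure_mono_null (fun y hy => hsub fun h => hy h.symm) hx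

theorem lintegral_kcomp (k : MarkovTransition X Y) (l : MarkovTransition (X × Y) Z) (x : X)
    {h : Z → ℝ≥0∞} (hh : Measurable[universalCompletion Z] h) :
    ∫⁻ z, h z ∂(k.kcomp l x) = ∫⁻ y, ∫⁻ z, h z ∂(l (x, y)) ∂(k x) :=
  lintegral_act _ _ hh

theorem lintegral_carry (k : MarkovTransition X Y) (x : X) {h : X × Y → ℝ≥0∞}
    (hh : Measurable[universalCompletion (X × Y)] h) :
    ∫⁻ q, h q ∂(k.carry x) = ∫⁻ y, h (x, y) ∂(k x) :=
  lintegral_map' (aemeasurable_of_universal hh (k.carry x)) measurable_prodMk_left.aemeasurable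

theorem lintegral_prod (k : MarkovTransition X Y) (m : MarkovTransition (X × Y) Z) (x : X)
    {h : Y × Z → ℝ≥0∞} (hh : Measurable[universalCompletion (Y × Z)] h) :
    ∫⁻ q, h q ∂(k.prod m x) = ∫⁻ y, ∫⁻ z, h (y, z) ∂(m (x, y)) ∂(k x) :=
  (lintegral_act _ _ hh).trans (lintegral_congr fun _ => lintegral_carry _ _ hh)

/-- Disintegration of `μ ⊗ k` with respect to its second marginal. -/
theorem exists_disintegration [StandardBorelSpace X] [Nonempty X] (k : MarkovTransition X Y)
    (μ : Measure X) [IsProbabilityMeasure μ] :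
    ∃ R : MarkovTransition Y X, ∀ h : X × Y → ℝ≥0∞,
      Measurable[universalCompletion (X × Y)] h →
      ∫⁻ y, ∫⁻ x, h (x, y) ∂(R y) ∂(k.act μ) = ∫⁻ x, ∫⁻ y, h (x, y) ∂(k x) ∂μ := by
  -- The joint law is swapped because `condKernel` conditions on the first coordinate.
  let ρ := (k.carry.act μ).map Prod.swap
  have hρ : IsProbabilityMeasure ρ := Measure.isProbabilityMeasure_map measurable_swap.aemeasurable
  have hfst : ρ.fst = k.act μ := by
    ext B hB
    rw [Measure.fst_apply hB, Measure.map_apply measurable_swap (measurable_fst hB),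
      act_apply _ _ (measurable_swap (measurable_fst hB)), act_apply _ _ hB]
    refine lintegral_congr fun x => ?_
    exact Measure.map_apply measurable_prodMk_left (measurable_swap (measurable_fst hB))
  let R : MarkovTransition Y X := ofKernel ρ.condKernel
  have hR : R.carry.act (k.act μ) = ρ := by
    ext E hE
    rw [act_apply _ _ hE, ← hfst]
    conv_rhs => rw [← ρ.disintegrate ρ.condKernel]
    rw [Measure.compProd_apply hE]
    exact lintegral_congr fun y => Measure.map_apply measurable_prodMk_left hE
  refine ⟨R, fun h hh => ?_⟩
  have hh' : Measurable[universalCompletion (Y × X)] fun q : Y × X => h q.swap :=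
    hh.comp (measurable_universalCompletion measurable_swap)
  calc ∫⁻ y, ∫⁻ x, h (x, y) ∂(R y) ∂(k.act μ)
      = ∫⁻ y, ∫⁻ q, h q.swap ∂(R.carry y) ∂(k.act μ) :=
        lintegral_congr fun y => (lintegral_carry R y hh').symm
    _ = ∫⁻ q, h q.swap ∂ρ := by rw [← lintegral_act _ _ hh', hR]
    _ = ∫⁻ q, h q ∂(k.carry.act μ) :=
        lintegral_map' (aemeasurable_of_universal hh' ρ) measurable_swap.aemeasurable
    _ = ∫⁻ x, ∫⁻ y, h (x, y) ∂(k x) ∂μ := by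
        rw [lintegral_act _ _ hh]
        exact lintegral_congr fun x => lintegral_carry k x hh

end MarkovTransition

/-- One integral is a finite sum, so measurability in `y` for each index suffices. -/
theorem lintegral_lintegral_swap_fintype {ι Y : Type*} [Fintype ι] [MeasurableSpace ι]
    [MeasurableSingletonClass ι] [MeasurableSpace Y] (ν : Measure ι) (μ : Measure Y)
    {F : ι → Y → ℝ≥0∞} (hF : ∀ i, AEMeasurable (F i) μ) :
    ∫⁻ i, ∫⁻ y, F i y ∂μ ∂ν = ∫⁻ y, ∫⁻ i, F i y ∂ν ∂μ := by
  simp_rw [lintegral_fintype]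
  rw [lintegral_finsetSum' _ fun i _ => (hF i).mul_const _]
  exact Finset.sum_congr rfl fun i _ => (lintegral_mul_const'' _ (hF i)).symm

/-! ### Score conversion and the simulation argument. -/

section Model

variable {Θ T X M : Type*} [MeasurableSpace Θ] [MeasurableSpace T] [MeasurableSpace X]
  [MeasurableSpace M] {S : Finset ℝ}

theorem inducedSCF_apply {π : Kernel (T × Θ) S} (mech : Mechanism M T X S) (σ : Strategy π M)
    (θ : Θ) {B : Set X} (hB : MeasurableSet B) :
    inducedSCF mech σ θ B = ∫⁻ m, ∫⁻ τ, ∫⁻ s, mech.decision ((m, τ), s) B ∂(σ.perform (θ, m, τ))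
      ∂(mech.testing m) ∂(σ.report θ) := by
  have hg := mech.decision.measurable_apply B hB
  rw [inducedSCF, MarkovTransition.comp_apply _ _ _ hB, MarkovTransition.lintegral_prod _ _ _ hg]
  have h2 := (σ.perform.comap (Prod.mk θ) measurable_prodMk_left).measurable_lintegral hg
  exact MarkovTransition.lintegral_prod _ _ _ h2

/-- The transition `L` turns the scores on the test `t θ` of a type that reports `θ` into scores in
a mechanism with performance strategy `p`: truthful scores become those of `p`, and any feasible
performance of any type becomes feasible on every test. -/
theorem IsMostDiscerning.exists_score_conversion
    [TopologicalSpace Θ] [PolishSpace Θ] [BorelSpace Θ]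
    [TopologicalSpace T] [PolishSpace T] [BorelSpace T]
    {π : Kernel (T × Θ) S} [IsMarkovKernel π] {t : Θ → T}
    (hmost : IsMostDiscerning π t) (ht : Measurable[universalCompletion Θ] t)
    (p : MarkovTransition (Θ × M × T) S) (hp : ∀ θ m τ, SDLE (p (θ, m, τ)) (π (τ, θ))) :
    ∃ L : MarkovTransition ((Θ × M × T) × S) S, ∀ θ m ψ,
      (π (t θ, θ)).bind (fun s => L ((θ, m, ψ), s)) = p (θ, m, ψ) ∧
      ∀ (θ' : Θ) (q : Measure S), SDLE q (π (t θ, θ')) →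
        SDLE (q.bind fun s => L ((θ, m, ψ), s)) (π (ψ, θ')) := by
  obtain ⟨K, hK⟩ := hmost.exists_transition ht
  obtain ⟨H, hH⟩ := exists_downward_transition (Y := Θ × M × T)
    ((MarkovTransition.ofKernel π).comap (fun x => (x.2.2, x.1)) (by fun_prop)) p
    fun x => hp x.1 x.2.1 x.2.2
  let L : MarkovTransition ((Θ × M × T) × S) S :=
    (K.comap (fun q : (Θ × M × T) × S => ((q.1.1, q.1.2.2), q.2)) (by fun_prop)).kcomp
      (H.comap (fun q : ((Θ × M × T) × S) × S => (q.1.1, q.2)) (by fun_prop))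
  have hL : ∀ θ m ψ (q : Measure S), q.bind (fun s => L ((θ, m, ψ), s)) =
      (q.bind fun s => K ((θ, ψ), s)).bind fun s => H ((θ, m, ψ), s) := by
    intro θ m ψ q
    rw [Measure.bind_bind Measurable.of_discrete.aemeasurable Measurable.of_discrete.aemeasurable]
    congr 1
    ext s B hB
    rw [Measure.bind_apply hB Measurable.of_discrete.aemeasurable]
    exact MarkovTransition.kcomp_apply _ _ _ hB
  refine ⟨L, fun θ m ψ => ⟨?_, fun θ' q hq => ?_⟩⟩
  · rw [hL, (hK θ ψ).2.2]
    exact (hH (θ, m, ψ)).1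
  · rw [hL]
    exact (sdle_bind_self (hH (θ, m, ψ)).2).trans
      ((hq.bind_mono (hK θ ψ).1).trans ((hK θ ψ).2.1 θ'))

end Model

theorem mainTheorem11
    {Θ : Type*} [TopologicalSpace Θ] [PolishSpace Θ] [MeasurableSpace Θ] [BorelSpace Θ]
    {T : Type*} [TopologicalSpace T] [PolishSpace T] [MeasurableSpace T] [BorelSpace T]
    (S : Finset ℝ) (π : Kernel (T × Θ) S) [IsMarkovKernel π]
    (t : Θ → T) (ht : Measurable[universalCompletion Θ] t) (hmost : IsMostDiscerning π t)
    {X : Type*} [TopologicalSpace X] [PolishSpace X] [MeasurableSpace X] [BorelSpace X]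
    (u : X × Θ → ℝ) (hu : Measurable u)
    (f : MarkovTransition Θ X) (hf : Implementable.{w} π u f) :
    CanonicallyImplementableWith π u (MarkovTransition.deterministic t ht) f := by
  obtain ⟨M, _, _, _, _, mech, σ, hIC, rfl⟩ := hf
  obtain ⟨L, hL⟩ := hmost.exists_score_conversion ht σ.perform σ.feasible
  let G : MarkovTransition ((Θ × M × T) × S) X := L.kcomp
    (mech.decision.comap (fun q : ((Θ × M × T) × S) × S => (q.1.1.2, q.2)) (by fun_prop))
  let G₁ : MarkovTransition (((Θ × T) × S) × M) X :=
    (mech.testing.comap (fun q : ((Θ × T) × S) × M => q.2) (by fun_prop)).kcomp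
      (G.comap (fun q : (((Θ × T) × S) × M) × T => ((q.1.1.1.1, q.1.2, q.2), q.1.1.2))
        (by fun_prop))
  let g : MarkovTransition ((Θ × T) × S) X :=
    (σ.report.comap (fun q : (Θ × T) × S => q.1.1) (by fun_prop)).kcomp G₁
  have hg : ∀ (ν : Measure S) θ τ {B : Set X}, MeasurableSet B → ∫⁻ s, g ((θ, τ), s) B ∂ν =
      ∫⁻ m, ∫⁻ ψ, ∫⁻ s, mech.decision ((m, ψ), s) B ∂(ν.bind fun s => L ((θ, m, ψ), s))
        ∂(mech.testing m) ∂(σ.report θ) := by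
    intro ν θ τ B hB
    have h1 : ∀ s, g ((θ, τ), s) B = ∫⁻ m, G₁ (((θ, τ), s), m) B ∂(σ.report θ) := fun s =>
      MarkovTransition.kcomp_apply _ _ _ hB
    have h2 : ∀ s m, G₁ (((θ, τ), s), m) B = ∫⁻ ψ, G ((θ, m, ψ), s) B ∂(mech.testing m) :=
      fun s m => MarkovTransition.kcomp_apply _ _ _ hB
    have h3 : ∀ s m ψ, G ((θ, m, ψ), s) B =
        ∫⁻ s', mech.decision ((m, ψ), s') B ∂(L ((θ, m, ψ), s)) := fun s m ψ =>
      MarkovTransition.kcomp_apply _ _ _ hB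
    simp_rw [h1]
    refine (lintegral_lintegral_swap_fintype _ _ fun s => aemeasurable_of_universal
      ((G₁.comap (Prod.mk ((θ, τ), s)) measurable_prodMk_left).measurable_apply B hB) _).trans ?_
    refine lintegral_congr fun m => (lintegral_congr fun s => h2 s m).trans ?_
    refine (lintegral_lintegral_swap_fintype _ _ fun s => aemeasurable_of_universal
      ((G.comap (fun ψ => ((θ, m, ψ), s)) (by fun_prop)).measurable_apply B hB) _).trans ?_
    refine lintegral_congr fun ψ => ?_
    rw [Measure.lintegral_bind Measurable.of_discrete.aemeasurable
      Measurable.of_discrete.aemeasurable]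
    exact lintegral_congr fun s => h3 s m ψ
  have hnew : ∀ (σ' : Strategy π Θ) θ {B : Set X}, MeasurableSet B →
      inducedSCF ⟨.deterministic t ht, g⟩ σ' θ B =
        ∫⁻ θ', ∫⁻ m, ∫⁻ ψ, ∫⁻ s, mech.decision ((m, ψ), s) B
          ∂((σ'.perform (θ, θ', t θ')).bind fun s => L ((θ', m, ψ), s))
          ∂(mech.testing m) ∂(σ.report θ') ∂(σ'.report θ) := by
    intro σ' θ B hB
    rw [inducedSCF_apply _ _ _ hB]
    refine lintegral_congr fun θ' => ?_
    exact (lintegral_dirac _ _).trans (hg _ _ _ hB)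
  let σc : Strategy π Θ :=
    { report := .id Θ
      perform := (MarkovTransition.ofKernel π).comap (fun x => (x.2.2, x.1)) (by fun_prop)
      feasible := fun _ _ _ _ => le_rfl }
  have hcan : inducedSCF mech σ = inducedSCF ⟨.deterministic t ht, g⟩ σc := by
    refine MarkovTransition.ext_apply fun θ B hB => ?_
    rw [inducedSCF_apply _ _ _ hB, hnew _ _ hB]
    refine Eq.trans ?_ (lintegral_dirac _ _).symm
    refine lintegral_congr fun m => lintegral_congr fun ψ => ?_
    rw [← (hL θ m ψ).1]
    rfl
  refine ⟨g, σc, ⟨rfl, fun _ _ => rfl⟩, fun σ' θ => ?_, hcan⟩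
  have : Nonempty Θ := ⟨θ⟩
  -- With the deviating type `θ` fixed, `Q` is its score law after each report `θ'`, and `D` the
  -- converted law on the hypothetical test.
  let Q : MarkovTransition Θ S := σ'.perform.comapUniversal (fun θ' => (θ, θ', t θ'))
    (measurable_universalCompletion_of_measurable
      (measurable_const.prodMk ((measurable_id.mono le_universalCompletion le_rfl).prodMk ht)))
  let D : MarkovTransition (Θ × M × T) S := (Q.comap Prod.fst measurable_fst).kcomp L
  have hD : ∀ θ' m ψ, D (θ', m, ψ) =
      (σ'.perform (θ, θ', t θ')).bind fun s => L ((θ', m, ψ), s) := by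
    intro θ' m ψ
    ext B hB
    rw [Measure.bind_apply hB Measurable.of_discrete.aemeasurable]
    exact MarkovTransition.kcomp_apply _ _ _ hB
  -- `R m` is the conditional law of the false report given the simulated message `m`; `P` averages
  -- `D` over it. Feasibility survives, since dominance is preserved under mixing.
  obtain ⟨R, hR⟩ := σ.report.exists_disintegration (σ'.report θ)
  let P : MarkovTransition (Θ × M × T) S :=
    (R.comap (fun x : Θ × M × T => x.2.1) (by fun_prop)).kcomp
      (D.comap (fun q : (Θ × M × T) × Θ => (q.2, q.1.2)) (by fun_prop))
  have hPfeas : ∀ m ψ, SDLE (P (θ, m, ψ)) (π (ψ, θ)) := by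
    intro m ψ x
    have h1 : P (θ, m, ψ) {s : S | (s : ℝ) ≤ x} =
        ∫⁻ θ', D (θ', m, ψ) {s : S | (s : ℝ) ≤ x} ∂(R m) :=
      MarkovTransition.kcomp_apply _ _ _ .of_discrete
    rw [h1]
    calc π (ψ, θ) {s : S | (s : ℝ) ≤ x}
        = ∫⁻ _, π (ψ, θ) {s : S | (s : ℝ) ≤ x} ∂(R m) := by simp
      _ ≤ _ := lintegral_mono fun θ' => by
          rw [hD]
          exact (hL θ' m ψ).2 θ _ (σ'.feasible θ θ' (t θ')) x
  have hA : MeasurableSet {x : Θ × M × T | x.1 = θ} := measurable_fst (measurableSet_singleton θ)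
  -- `P` is built for type `θ` alone, so other types keep their performance from `σ`; incentive
  -- constraints are checked type by type.
  let σ'' : Strategy π M :=
    { report := σ'.report.comp σ.report
      perform := .piecewise _ hA P σ.perform
      feasible := by
        intro θ₁ m ψ
        by_cases h : θ₁ = θ
        · rw [MarkovTransition.piecewise_of_mem hA _ _ (by exact h), h]
          exact hPfeas m ψ
        · rw [MarkovTransition.piecewise_of_notMem hA _ _ (by exact h)]
          exact σ.feasible θ₁ m ψ }
  have hdev : inducedSCF ⟨.deterministic t ht, g⟩ σ' θ = inducedSCF mech σ'' θ := by
    ext B hB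
    let W : MarkovTransition (Θ × M × T) X := D.kcomp
      (mech.decision.comap (fun q : (Θ × M × T) × S => (q.1.2, q.2)) (by fun_prop))
    have hW : ∀ θ' m ψ, W (θ', m, ψ) B =
        ∫⁻ s, mech.decision ((m, ψ), s) B ∂(D (θ', m, ψ)) := fun θ' m ψ =>
      MarkovTransition.kcomp_apply _ _ _ hB
    let Φ : MarkovTransition (Θ × M) X :=
      (mech.testing.comap (fun q : Θ × M => q.2) (by fun_prop)).kcomp
        (W.comap (fun q : (Θ × M) × T => (q.1.1, q.1.2, q.2)) (by fun_prop))
    have hΦ : ∀ θ' m, Φ (θ', m) B = ∫⁻ ψ, W (θ', m, ψ) B ∂(mech.testing m) := fun θ' m =>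
      MarkovTransition.kcomp_apply _ _ _ hB
    calc inducedSCF ⟨.deterministic t ht, g⟩ σ' θ B
        = ∫⁻ θ', ∫⁻ m, Φ (θ', m) B ∂(σ.report θ') ∂(σ'.report θ) := by
          rw [hnew _ _ hB]
          simp_rw [hΦ, hW, hD]
      _ = ∫⁻ m, ∫⁻ θ', Φ (θ', m) B ∂(R m) ∂(σ''.report θ) :=
          (hR _ (Φ.measurable_apply B hB)).symm
      -- Given the message, the test is drawn independently of the report, so Fubini applies.
      _ = ∫⁻ m, ∫⁻ ψ, ∫⁻ θ', W (θ', m, ψ) B ∂(R m) ∂(mech.testing m) ∂(σ''.report θ) := by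
          refine lintegral_congr fun m => ?_
          simp_rw [hΦ]
          exact lintegral_lintegral_swap (aemeasurable_of_universal
            ((W.comap (fun q : Θ × T => (q.1, m, q.2)) (by fun_prop)).measurable_apply B hB) _)
      _ = inducedSCF mech σ'' θ B := by
          rw [inducedSCF_apply _ _ _ hB]
          refine lintegral_congr fun m => lintegral_congr fun ψ => ?_
          have h1 : σ''.perform (θ, m, ψ) = P (θ, m, ψ) :=
            MarkovTransition.piecewise_of_mem hA _ _ rfl
          rw [h1]
          have h2 := MarkovTransition.lintegral_kcomp
            (R.comap (fun x : Θ × M × T => x.2.1) (by fun_prop))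
            (D.comap (fun q : (Θ × M × T) × Θ => (q.2, q.1.2)) (by fun_prop)) (θ, m, ψ)
            (h := fun s => mech.decision ((m, ψ), s) B)
            ((mech.decision.comap (Prod.mk (m, ψ)) measurable_prodMk_left).measurable_apply B hB)
          exact (lintegral_congr fun θ' => hW θ' m ψ).trans h2.symm
  -- The outcome laws coincide as measures, so well-definedness of expected utility and optimality
  -- both transfer.
  rw [hdev, ← hcan]
  exact hIC σ'' θ
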